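/- Let $d\ge 2$ and $k\ge 1$ be integers. Let $K\subset\mathbb{R}^d$ be a nondegenerate closed $d$-simplex with vertices $x_1,\dots,x_{d+1}$, let $x_0$ be a point in the interior of $K$, and let $K^r=\{K_1,\dots,K_{d+1}\}$ be the refinement of $K$ in which $K_i$ is the simplex with vertex set $\{x_0,x_1,\dots,x_{d+1}\}\setminus\{x_i\}$. For a simplex $T$ let $h_T$ be its diameter and $\rho_T$ the diameter of the largest ball contained in $T$; the shape regularity constant of $K^r$ is $\mathcal{C}_K=\max_{1\le i\le d+1} h_{K_i}/\rho_{K_i}$. Let $\mathring{P}_{k-1}(K^r)$ be the space of all $p\in L^2(K)$ with $\int_K p\,dx=0$ whose restriction to each $K_i$ is a polynomial of degree at most $k-1$, and let $\mathring{\boldsymbol P}{}^c_k(K^r)$ be the space of all vector fields $v\in [H^1_0(K)]^d$ such that on each $K_i$ every component of $v$ is a polynomial of degree at most $k$ (so $v$ has a representative that is continuous on $K$ and vanishes on $\partial K$). Then for every $\gamma>0$ there is a constant $C>0$, depending only on $d$, $k$ and $\gamma$, such that the following holds for every such $K$ and $x_0$ with $\mathcal{C}_K\le\gamma$. For every $p\in\mathring{P}_{k-1}(K^r)$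 there exists $v\in\mathring{\boldsymbol P}{}^c_k(K^r)$ with $$\operatorname{div} v=p\quad\text{on }K,\qquad \|v\|_{H^1(K)}\le C\,\max\{1,h_K\}\,\|p\|_{L^2(K)},$$ where $\|v\|_{H^1(K)}^2=\|v\|_{L^2(K)}^2+\|\nabla v\|_{L^2(K)}^2$. In particular $\|v\|_{H^1(K)}\le C\|p\|_{L^2(K)}$ whenever $h_K\le 1$; and if $K$ is an element of a triangulation of a bounded domain $\Omega$, the bound $\|v\|_{H^1(K)}\le C_\Omega\|p\|_{L^2(K)}$ holds with $C_\Omega=C\max\{1,\operatorname{diam}\Omega\}$. -/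

import Mathlib

open MeasureTheory Filter Topology
open scoped ContDiff

namespace LocalInfSup

/-- `ℝ^d` with the Euclidean norm. -/
abbrev Space (d : ℕ) : Type := EuclideanSpace ℝ (Fin d)

/-! ### The macro simplex, its refinement, and shape regularity -/

/-- The closed `d`-simplex spanned by its vertices. -/
def body {d : ℕ} (K : Affine.Simplex ℝ (Space d) d) : Set (Space d) :=
  convexHull ℝ (Set.range K.points)

/-- The cell of the refinement opposite to the `i`-th vertex: the closed simplex whose vertices are
`x₀` and all the vertices of `K` except the `i`-th one. -/
def subcell {d : ℕ} (K : Affine.Simplex ℝ (Space d) d) (x₀ : Space d) (i : Fin (d + 1)) :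
    Set (Space d) :=
  convexHull ℝ (Set.range (Function.update K.points i x₀))

/-- The diameter of the largest ball contained in `S`. -/
noncomputable def inballDiam {d : ℕ} (S : Set (Space d)) : ℝ :=
  sSup {δ : ℝ | ∃ (c : Space d) (r : ℝ), 0 ≤ r ∧ Metric.closedBall c r ⊆ S ∧ δ = 2 * r}

/-- The shape regularity constant of a simplex: diameter over diameter of the largest inscribed
ball. -/
noncomputable def shapeConst {d : ℕ} (S : Set (Space d)) : ℝ :=
  Metric.diam S / inballDiam S

/-- The shape regularity constant of the refinement: the maximum over its `d + 1` cells. -/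
noncomputable def refinedShapeConst {d : ℕ} (K : Affine.Simplex ℝ (Space d) d) (x₀ : Space d) : ℝ :=
  Finset.univ.sup' Finset.univ_nonempty (fun i : Fin (d + 1) => shapeConst (subcell K x₀ i))

/-! ### Sobolev spaces on (the interior of) a set -/

/-- The partial derivative of a differentiable function in the `j`-th coordinate direction. -/
noncomputable def partialDeriv {d : ℕ} (j : Fin d) (φ : Space d → ℝ) (x : Space d) : ℝ :=
  fderiv ℝ φ x (EuclideanSpace.single j 1)

/-- Smooth functions with compact support in the interior of `S`. -/
structure IsTestFunction {d : ℕ} (S : Set (Space d)) (φ : Space d → ℝ) : Prop where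
  smooth : ContDiff ℝ ∞ φ
  compact : HasCompactSupport φ
  support : tsupport φ ⊆ interior S

/-- `u` belongs to `H¹(S)`, and `g j` is its `j`-th weak partial derivative. -/
structure HasH1Grad {d : ℕ} (S : Set (Space d)) (u : Space d → ℝ) (g : Fin d → Space d → ℝ) :
    Prop where
  memLp : MemLp u 2 (volume.restrict S)
  memLp_grad : ∀ j, MemLp (g j) 2 (volume.restrict S)
  weak : ∀ φ, IsTestFunction S φ → ∀ j,
    ∫ x in S, u x * partialDeriv j φ x = - ∫ x in S, g j x * φ x

/-- `u` belongs to `H¹₀(S)`, the closure of the test functions in `H¹(S)`. -/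
def MemH10 {d : ℕ} (S : Set (Space d)) (u : Space d → ℝ) : Prop :=
  ∃ g : Fin d → Space d → ℝ, HasH1Grad S u g ∧
    ∃ φ : ℕ → Space d → ℝ, (∀ n, IsTestFunction S (φ n)) ∧
      Tendsto (fun n => eLpNorm (fun x => u x - φ n x) 2 (volume.restrict S)) atTop (𝓝 0) ∧
      ∀ j, Tendsto (fun n => eLpNorm (fun x => g j x - partialDeriv j (φ n) x) 2
        (volume.restrict S)) atTop (𝓝 0)

/-- The norm of `L²(S)`, for `u ∈ L²(S)`. -/
noncomputable def l2Norm {d : ℕ} (S : Set (Space d)) (u : Space d → ℝ) : ℝ :=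
  Real.sqrt (∫ x in S, u x ^ 2)

/-- The full `H¹(S)` norm of a vector field `v`, where `G i j` is the `j`-th weak partial derivative
of the `i`-th component of `v`. -/
noncomputable def h1Norm {d : ℕ} (S : Set (Space d)) (v : Space d → Space d)
    (G : Fin d → Fin d → Space d → ℝ) : ℝ :=
  Real.sqrt (∑ i, l2Norm S (fun x => v x i) ^ 2 + ∑ i, ∑ j, l2Norm S (G i j) ^ 2)

/-! ### The finite element spaces on the refinement -/

/-- On every cell of the refinement `u` is (almost everywhere) a polynomial of degree at most
`m`. -/
def IsPiecewisePoly {d : ℕ} (m : ℕ) (K : Affine.Simplex ℝ (Space d) d) (x₀ : Space d)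
    (u : Space d → ℝ) : Prop :=
  ∀ i : Fin (d + 1), ∃ q : MvPolynomial (Fin d) ℝ, q.totalDegree ≤ m ∧
    ∀ᵐ x ∂(volume.restrict (subcell K x₀ i)), u x = MvPolynomial.eval (fun j => x j) q

/-- The pressure space: mean-zero `L²` functions on `K`, piecewise polynomial of degree at most
`m`. -/
structure MemPressure {d : ℕ} (m : ℕ) (K : Affine.Simplex ℝ (Space d) d) (x₀ : Space d)
    (p : Space d → ℝ) : Prop where
  memLp : MemLp p 2 (volume.restrict (body K))
  mean_zero : ∫ x in body K, p x = 0
  poly : IsPiecewisePoly m K x₀ p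

/-- The velocity space: fields with components in `H¹₀(K)`, piecewise polynomial of degree at most
`m`. -/
structure MemVelocity {d : ℕ} (m : ℕ) (K : Affine.Simplex ℝ (Space d) d) (x₀ : Space d)
    (v : Space d → Space d) : Prop where
  memH10 : ∀ i, MemH10 (body K) (fun x => v x i)
  poly : ∀ i, IsPiecewisePoly m K x₀ (fun x => v x i)

end LocalInfSup

/-!
Let `μ` be the piecewise affine function on the split of `K` at `x₀` with `μ x₀ = 1` that vanishes on
the boundary of `K` (`apexHat`), and let `λ_j` be the hat function of the `j`-th vertex
(`vertexHat`). With the barycentric coordinates `β_i` of `K` and `t_i = β_i x₀ > 0`, one has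
`μ = min_i β_i / t_i` and `λ_j = β_j - t_j μ`, the minimum being attained at `i = l` on the cell `K_l`
opposite to the `l`-th vertex. There `∇μ = ∇β_l / t_l`, so that `∇μ` on `K_l` has product
`(δ_jl - δ_il) / t_l` with the edge vector `x_j - x_i`.

On `K_l` a polynomial of degree at most `m = k - 1` is homogeneous of degree `m` in `μ` and the `λ_j`,
`j ≠ l` (`exists_baryMonomial_expansion`). By linearity it suffices to find a field whose divergence is
a monomial `μ^(m-n) λ_{a 1} ⋯ λ_{a n}` on one cell `K_i`, where no `a r` is `i`, and zero on the others
(`cellMonomial`). For `n ≥ 1` put `w = t_i (x_i - x_{a 1})`. The field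
`μ^(m-n+1) λ_{a 1} ⋯ λ_{a n} w / (m-n+1)` vanishes on the boundary of `K`. In its divergence, the terms
containing `∇μ` add up to the given monomial: `∇μ ⬝ w` is `1` on `K_i` and zero on the other cells,
except on the one opposite to the vertex `a 1`, where `λ_{a 1} = 0`. The other terms are piecewise
combinations of monomials with `n - 1` factors `λ`, so one can induct on `n`
(`Solvable.cellMonomial_of_erase`). For `n = 0` the field `μ^(m+1) t_i (x_i - x₀) / (m+1)` works up to
the multiple `t_i μ^m` of `μ^m` (`solvable_cellMonomial_empty`). In total the pressure is a divergence
plus `σ μ^m` for some constant `σ`, and since divergences of such fields have mean zero and `μ` is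
positive in the interior, `σ = 0` when the pressure has mean zero
(`SolvesDiv.eq_zero_of_integral_eq_zero`).

All bounds are explicit in this construction. Shape regularity gives `h_K ≤ γ² ρ_{K_l}` for all `l`,
since any two cells share an edge (`diam_hull_le`); hence `h_K |∇λ_j|`, `h_K |∇μ|` and `|K| / |K_l|` are
bounded, while `|w| ≤ h_K`. The coefficients of a polynomial on `K_l` are bounded by its root mean
square, by affine equivalence with a fixed simplex.

The fields are Lipschitz and piecewise polynomial. Their membership in `H¹₀` follows by contracting
towards `x₀` and mollifying (`memH10_of_lipschitzWith`).
-/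

namespace LocalInfSup

open Metric Set
open scoped NNReal ENNReal Convolution

variable {d : ℕ}

/-! ### Mollification and `H¹₀` membership of Lipschitz functions -/

theorem tendsto_eLpNorm_two_zero {α : Type*} [MeasurableSpace α] {ν : Measure α}
    [IsFiniteMeasure ν] {u : ℕ → α → ℝ} {B : ℝ}
    (hm : ∀ n, AEStronglyMeasurable (u n) ν) (hB : ∀ n, ∀ᵐ x ∂ν, |u n x| ≤ B)
    (hu : ∀ᵐ x ∂ν, Tendsto (fun n => u n x) atTop (𝓝 0)) :
    Tendsto (fun n => eLpNorm (u n) 2 ν) atTop (𝓝 0) := by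
  have h1 : Tendsto (fun n => ∫⁻ x, ‖u n x‖ₑ ^ (2 : ℝ) ∂ν) atTop (𝓝 (∫⁻ _, 0 ∂ν)) := by
    refine tendsto_lintegral_of_dominated_convergence' (fun _ => ENNReal.ofReal B ^ (2 : ℝ))
      (fun n => (hm n).enorm.pow_const _) (fun n => ?_) ?_ ?_
    · filter_upwards [hB n] with x hx
      gcongr
      rw [Real.enorm_eq_ofReal_abs]
      exact ENNReal.ofReal_le_ofReal hx
    · rw [lintegral_const]
      exact ENNReal.mul_ne_top (by finiteness) (measure_ne_top _ _)
    · filter_upwards [hu] with x hx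
      have h2 := ((continuous_enorm.tendsto (0 : ℝ)).comp hx)
      have h3 := ((ENNReal.continuous_rpow_const (y := (2 : ℝ))).tendsto _).comp h2
      simpa [Function.comp_def] using h3
  have h2 := ((ENNReal.continuous_rpow_const (y := 1 / (2 : ℝ))).tendsto _).comp h1
  simp only [eLpNorm_eq_lintegral_rpow_enorm_toReal (p := 2) (by norm_num) (by norm_num)]
  simpa [Function.comp_def] using h2

theorem abs_integral_normed_mul_le (ρ : ContDiffBump (0 : Space d)) {g : Space d → ℝ} {B : ℝ}
    (hB : ∀ t ∈ ball (0 : Space d) ρ.rOut, |g t| ≤ B) :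
    |∫ t, ρ.normed volume t * g t| ≤ B := by
  have h := norm_integral_le_of_norm_le (μ := volume) (f := fun t => ρ.normed volume t * g t)
    (g := fun t => ρ.normed volume t * B) (ρ.integrable_normed.mul_const B)
    (Eventually.of_forall fun t => ?_)
  · rwa [integral_mul_const, ρ.integral_normed, one_mul] at h
  · rw [norm_mul, Real.norm_of_nonneg (ρ.nonneg_normed t)]
    by_cases ht : t ∈ ball (0 : Space d) ρ.rOut
    · exact mul_le_mul_of_nonneg_left (hB t ht) (ρ.nonneg_normed t)
    · have : ρ.normed volume t = 0 := by
        rw [← ρ.support_normed_eq (μ := volume)] at ht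
        exact Function.notMem_support.mp ht
      simp [this]

/-- The mollification of `F` by the normalized bump function `ρ`. -/
noncomputable def mollify (ρ : ContDiffBump (0 : Space d)) (F : Space d → ℝ) : Space d → ℝ :=
  ρ.normed volume ⋆[ContinuousLinearMap.lsmul ℝ ℝ, volume] F

theorem mollify_apply (ρ : ContDiffBump (0 : Space d)) (F : Space d → ℝ) (x : Space d) :
    mollify ρ F x = ∫ t, ρ.normed volume t * F (x - t) := by
  simp [mollify, convolution_def]

theorem integrable_normed_mul (ρ : ContDiffBump (0 : Space d)) {F : Space d → ℝ}
    (hF : Continuous F) : Integrable (fun t => ρ.normed volume t * F t) := by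
  refine (ρ.continuous_normed.mul hF).integrable_of_hasCompactSupport ?_
  exact ρ.hasCompactSupport_normed.mul_right

theorem contDiff_mollify (ρ : ContDiffBump (0 : Space d)) {F : Space d → ℝ}
    (hF : Continuous F) : ContDiff ℝ ∞ (mollify ρ F) :=
  ρ.hasCompactSupport_normed.contDiff_convolution_left _ ρ.contDiff_normed hF.locallyIntegrable

theorem abs_mollify_sub_le (ρ : ContDiffBump (0 : Space d)) {F : Space d → ℝ}
    (hF : Continuous F) {x : Space d} {a B : ℝ}
    (h : ∀ t ∈ ball (0 : Space d) ρ.rOut, |F (x - t) - a| ≤ B) :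
    |mollify ρ F x - a| ≤ B := by
  have h1 := abs_integral_normed_mul_le ρ h
  simp only [mul_sub] at h1
  rwa [integral_sub (integrable_normed_mul ρ (by fun_prop)) (ρ.integrable_normed.mul_const a),
    integral_mul_const, ρ.integral_normed, one_mul, ← mollify_apply] at h1

theorem abs_mollify_sub_mollify_sub_le (ρ : ContDiffBump (0 : Space d)) {F : Space d → ℝ}
    (hF : Continuous F) {x y : Space d} {a B : ℝ}
    (h : ∀ t ∈ ball (0 : Space d) ρ.rOut, |F (x - t) - F (y - t) - a| ≤ B) :
    |mollify ρ F x - mollify ρ F y - a| ≤ B := by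
  have h1 := abs_integral_normed_mul_le ρ h
  have hx : Integrable (fun t => ρ.normed volume t * F (x - t)) :=
    integrable_normed_mul ρ (by fun_prop)
  have hy : Integrable (fun t => ρ.normed volume t * F (y - t)) :=
    integrable_normed_mul ρ (by fun_prop)
  have h2 : ∫ t, ρ.normed volume t * (F (x - t) - F (y - t) - a) =
      mollify ρ F x - mollify ρ F y - a := by
    simp only [mul_sub]
    have hxy : Integrable (fun t => ρ.normed volume t * F (x - t) - ρ.normed volume t * F (y - t)) :=
      hx.sub hy
    rw [integral_sub hxy (ρ.integrable_normed.mul_const a), integral_sub hx hy,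
      integral_mul_const, ρ.integral_normed, one_mul, mollify_apply, mollify_apply]
  rwa [h2] at h1

theorem lipschitzWith_mollify (ρ : ContDiffBump (0 : Space d)) {F : Space d → ℝ} {L : ℝ≥0}
    (hF : LipschitzWith L F) : LipschitzWith L (mollify ρ F) := by
  refine LipschitzWith.of_dist_le_mul fun x y => ?_
  have := abs_mollify_sub_mollify_sub_le ρ hF.continuous (x := x) (y := y) (a := 0)
    (B := L * dist x y) fun t _ => ?_
  · simpa [Real.dist_eq] using this
  · have := hF.dist_le_mul (x - t) (y - t)
    simpa [Real.dist_eq] using this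

/-- The gradient at `x` of a mollified dilation of `f` is close to `s • A` if `f` has a uniform
first-order expansion with gradient `A` near `x`; no derivative of `f` has to be averaged. -/
theorem norm_fderiv_mollify_sub_le (ρ : ContDiffBump (0 : Space d)) {f : Space d → ℝ} {L : ℝ≥0}
    (hf : LipschitzWith L f) {x x₀ : Space d} {s ε δ : ℝ} (hs : 0 ≤ s) (hε : 0 ≤ ε)
    {A : Space d →L[ℝ] ℝ}
    (hA : ∀ y ∈ ball x δ, ∀ z ∈ ball x δ, |f y - f z - A (y - z)| ≤ ε * ‖y - z‖)
    (hδ : ∀ t ∈ ball (0 : Space d) ρ.rOut, AffineMap.homothety x₀ s (x - t) ∈ ball x (δ / 2)) :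
    ‖fderiv ℝ (mollify ρ (fun y => f (AffineMap.homothety x₀ s y))) x - s • A‖ ≤ s * ε := by
  have hcont : Continuous (fun y => f (AffineMap.homothety x₀ s y)) :=
    hf.continuous.comp (AffineMap.homothety_continuous x₀ s)
  have hd : HasFDerivAt (mollify ρ (fun y => f (AffineMap.homothety x₀ s y)))
      (fderiv ℝ (mollify ρ (fun y => f (AffineMap.homothety x₀ s y))) x) x :=
    ((contDiff_mollify ρ hcont).differentiable (by simp)).differentiableAt.hasFDerivAt
  have hd2 := hd.sub (s • A).hasFDerivAt
  have hT : ∀ u w : Space d, AffineMap.homothety x₀ s u - AffineMap.homothety x₀ s w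
      = s • (u - w) := by
    intro u w
    simp only [AffineMap.homothety_apply, vsub_eq_sub, vadd_eq_add]
    module
  have hδ0 : 0 < δ := by
    have := hδ 0 (mem_ball_self ρ.rOut_pos)
    have := dist_nonneg.trans_lt (mem_ball.1 this)
    linarith
  refine hd2.le_of_lip' (by positivity) ?_
  have hnear : ∀ᶠ y in 𝓝 x, s * ‖y - x‖ < δ / 2 := by
    have : Tendsto (fun y : Space d => s * ‖y - x‖) (𝓝 x) (𝓝 (s * ‖x - x‖)) :=
      Continuous.tendsto (by fun_prop) x
    rw [sub_self, norm_zero, mul_zero] at this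
    exact this.eventually_lt_const (by linarith)
  filter_upwards [hnear] with y hy
  have := abs_mollify_sub_mollify_sub_le ρ hcont (x := y) (y := x) (a := (s • A) (y - x))
    (B := s * ε * ‖y - x‖) fun t ht => ?_
  · rw [Real.norm_eq_abs]
    convert this using 2
    simp only [Pi.sub_apply, map_sub]
    ring
  · have h1 := hδ t ht
    have h3 : AffineMap.homothety x₀ s (y - t) - AffineMap.homothety x₀ s (x - t)
        = s • (y - x) := by rw [hT]; congr 1; abel
    have h2 : AffineMap.homothety x₀ s (y - t) ∈ ball x δ := by
      rw [mem_ball] at h1 ⊢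
      have h4 : dist (AffineMap.homothety x₀ s (y - t)) (AffineMap.homothety x₀ s (x - t))
          = s * ‖y - x‖ := by rw [dist_eq_norm, h3, norm_smul, Real.norm_of_nonneg hs]
      have := dist_triangle (AffineMap.homothety x₀ s (y - t))
        (AffineMap.homothety x₀ s (x - t)) x
      linarith
    have := hA _ h2 _ (ball_subset_ball (by linarith) h1)
    rw [h3, norm_smul, Real.norm_of_nonneg hs, map_smul] at this
    simp only [smul_apply]
    linarith

theorem lineDeriv_eq_partialDeriv {φ : Space d → ℝ} {x : Space d} (h : DifferentiableAt ℝ φ x)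
    (j : Fin d) : lineDeriv ℝ φ x (EuclideanSpace.single j 1) = partialDeriv j φ x :=
  h.lineDeriv_eq_fderiv

/-- A Lipschitz function vanishing off `S` has its line derivatives as weak derivatives on `S`. -/
theorem hasH1Grad_lineDeriv {S : Set (Space d)} (hb : Bornology.IsBounded S)
    {f : Space d → ℝ} {L : ℝ≥0} (hf : LipschitzWith L f) (h0 : ∀ x ∉ S, f x = 0) :
    HasH1Grad S f (fun j x => lineDeriv ℝ f x (EuclideanSpace.single j 1)) := by
  have hfin : IsFiniteMeasure (volume.restrict S) := ⟨by
    rw [Measure.restrict_apply_univ]; exact hb.measure_lt_top⟩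
  have hcs : HasCompactSupport f :=
    HasCompactSupport.of_support_subset_isCompact hb.isCompact_closure fun x hx =>
      subset_closure (by by_contra h; exact hx (h0 x h))
  refine ⟨?_, fun j => ?_, fun φ hφ j => ?_⟩
  · exact (hf.continuous.memLp_of_hasCompactSupport hcs).restrict S
  · refine MemLp.of_bound (measurable_lineDeriv hf.continuous).aestronglyMeasurable
      (L * ‖(EuclideanSpace.single j 1 : Space d)‖) (Eventually.of_forall fun x => ?_)
    exact norm_lineDeriv_le_of_lipschitz ℝ hf
  · obtain ⟨D, hD⟩ := hφ.smooth.lipschitzWith_of_hasCompactSupport hφ.compact (by simp)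
    have h := LipschitzWith.integral_lineDeriv_mul_eq (μ := volume) hf hD hφ.compact (EuclideanSpace.single j 1)
    have hφ0 : ∀ x ∉ S, φ x = 0 := fun x hx =>
      image_eq_zero_of_notMem_tsupport fun h => hx (interior_subset (hφ.support h))
    rw [setIntegral_eq_integral_of_forall_compl_eq_zero (fun x hx => by rw [h0 x hx, zero_mul]),
      setIntegral_eq_integral_of_forall_compl_eq_zero (fun x hx => by rw [hφ0 x hx, mul_zero]), h,
      ← integral_neg]
    congr 1 with x
    rw [lineDeriv_neg, lineDeriv_eq_partialDeriv (hφ.smooth.differentiable (by simp) x)]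
    ring

/-- A Lipschitz function with compact support has line derivatives of mean zero. -/
theorem integral_lineDeriv_eq_zero {f : Space d → ℝ} {L : ℝ≥0} (hf : LipschitzWith L f)
    (hcs : HasCompactSupport f) (e : Space d) : ∫ x, lineDeriv ℝ f x e = 0 := by
  have h := LipschitzWith.integral_lineDeriv_mul_eq (μ := volume) (LipschitzWith.const (1 : ℝ)) hf hcs (-e)
  have h1 : ∀ x : Space d, lineDeriv ℝ (fun _ => (1 : ℝ)) x (-e) = 0 := by simp [lineDeriv]
  simpa [h1] using h.symm

/-- A Lipschitz function vanishing off the interior of a bounded convex set `S` is in `H¹₀(S)`: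
contracting the function slightly towards an interior point moves its support into the interior,
and mollifying the contracted function then gives test functions. -/
theorem memH10_of_lipschitzWith {S : Set (Space d)} (hc : Convex ℝ S)
    (hb : Bornology.IsBounded S) {x₀ : Space d} (hx₀ : x₀ ∈ interior S) {f : Space d → ℝ}
    {L : ℝ≥0} (hf : LipschitzWith L f) (h0 : ∀ x ∉ interior S, f x = 0)
    (hd : ∀ᵐ x ∂volume.restrict S, ∃ A : Space d →L[ℝ] ℝ, HasStrictFDerivAt f A x) :
    MemH10 S f := by
  have hfin : IsFiniteMeasure (volume.restrict S) := ⟨by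
    rw [Measure.restrict_apply_univ]; exact hb.measure_lt_top⟩
  have hcs : HasCompactSupport f :=
    HasCompactSupport.of_support_subset_isCompact hb.isCompact_closure fun x hx =>
      subset_closure (interior_subset (by by_contra h; exact hx (h0 x h)))
  obtain ⟨B, hB⟩ := hf.continuous.bounded_above_of_compact_support hcs
  set s : ℕ → ℝ := fun n => 1 + 1 / ((n : ℝ) + 1) with hs_def
  have hs1 : ∀ n, 1 < s n := fun n => by
    simp only [hs_def]; have : (0 : ℝ) < 1 / ((n : ℝ) + 1) := by positivity
    linarith
  have hs2 : ∀ n, s n ≤ 2 := fun n => by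
    simp only [hs_def]
    have : 1 / ((n : ℝ) + 1) ≤ 1 := by
      rw [div_le_one (by positivity)]; have := n.cast_nonneg (α := ℝ); linarith
    linarith
  have hslim : Tendsto s atTop (𝓝 1) := by
    simpa [hs_def] using (tendsto_one_div_add_atTop_nhds_zero_nat (𝕜 := ℝ)).const_add 1
  have hsub : ∀ n, ∃ δ : ℝ, 0 < δ ∧
      cthickening δ ((AffineMap.homothety x₀ (s n)) ⁻¹' closure S) ⊆ interior S := by
    intro n
    have hs0 : s n ≠ 0 := by have := hs1 n; linarith
    have hinj : Function.Injective (AffineMap.homothety x₀ (s n) : Space d → Space d) := by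
      intro u w huw
      simp only [AffineMap.homothety_apply, vsub_eq_sub, vadd_eq_add, add_left_inj] at huw
      simpa using smul_right_injective (Space d) hs0 huw
    refine IsCompact.exists_cthickening_subset_open ?_ isOpen_interior ?_
    · have : (AffineMap.homothety x₀ (s n)) ⁻¹' closure S
          = (AffineMap.homothety x₀ (s n)⁻¹) '' closure S := by
        ext y
        simp only [mem_preimage, mem_image]
        constructor
        · intro hy
          refine ⟨_, hy, ?_⟩
          simp [AffineMap.homothety_apply, smul_smul, hs0]
        · rintro ⟨z, hz, rfl⟩
          convert hz using 1
          simp [AffineMap.homothety_apply, smul_smul, hs0]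
      rw [this]
      exact hb.isCompact_closure.image (AffineMap.homothety_continuous _ _)
    · intro y hy
      obtain ⟨z, hz, hzy⟩ := hc.closure_subset_image_homothety_interior_of_one_lt hx₀ _ (hs1 n) hy
      rwa [← hinj hzy]
  choose δ hδ hδS using hsub
  set r : ℕ → ℝ := fun n => min (δ n) (1 / ((n : ℝ) + 1)) with hr_def
  have hr : ∀ n, 0 < r n := fun n => lt_min (hδ n) (by positivity)
  have hrlim : Tendsto r atTop (𝓝 0) := squeeze_zero (fun n => (hr n).le)
    (fun n => min_le_right _ _) tendsto_one_div_add_atTop_nhds_zero_nat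
  set ρ : ℕ → ContDiffBump (0 : Space d) := fun n =>
    ⟨r n / 2, r n, by have := hr n; linarith, by have := hr n; linarith⟩ with hρ_def
  set F : ℕ → Space d → ℝ := fun n y => f (AffineMap.homothety x₀ (s n) y) with hF_def
  have hdist : ∀ n (u w : Space d), dist (AffineMap.homothety x₀ (s n) u)
      (AffineMap.homothety x₀ (s n) w) = s n * dist u w := by
    intro n u w
    rw [dist_eq_norm, dist_eq_norm, ← Real.norm_of_nonneg (zero_le_one.trans (hs1 n).le),
      ← norm_smul]
    congr 1
    simp only [AffineMap.homothety_apply, vsub_eq_sub, vadd_eq_add]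
    rw [Real.norm_of_nonneg (zero_le_one.trans (hs1 n).le)]
    module
  have hFL : ∀ n, LipschitzWith (2 * L) (F n) := by
    intro n
    refine LipschitzWith.of_dist_le_mul fun u w => ?_
    refine (hf.dist_le_mul _ _).trans ?_
    rw [hdist]
    push_cast
    have := mul_le_mul_of_nonneg_right (hs2 n) (dist_nonneg (x := u) (y := w))
    nlinarith [L.coe_nonneg]
  -- The displacement of the points at which `f` is averaged tends to zero.
  have hnear : ∀ x : Space d, ∀ η > 0, ∀ᶠ n in atTop, ∀ t ∈ ball (0 : Space d) (ρ n).rOut,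
      AffineMap.homothety x₀ (s n) (x - t) ∈ ball x η := by
    intro x η hη
    have h1 : Tendsto (fun n => 2 * r n + (s n - 1) * ‖x - x₀‖) atTop (𝓝 0) := by
      have := (hrlim.const_mul 2).add ((hslim.sub_const 1).mul_const ‖x - x₀‖)
      simpa using this
    filter_upwards [h1.eventually_lt_const hη] with n hn t ht
    have ht' : ‖t‖ < r n := by simpa [hρ_def] using ht
    rw [mem_ball, dist_eq_norm]
    have e : AffineMap.homothety x₀ (s n) (x - t) - x = (s n - 1) • (x - x₀) - s n • t := by
      simp only [AffineMap.homothety_apply, vsub_eq_sub, vadd_eq_add]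
      module
    rw [e]
    refine (norm_sub_le _ _).trans_lt (lt_of_le_of_lt ?_ hn)
    rw [norm_smul, norm_smul, Real.norm_of_nonneg (by linarith [hs1 n]),
      Real.norm_of_nonneg (by linarith [hs1 n])]
    nlinarith [hs2 n, norm_nonneg t, hr n]
  have htest : ∀ n, IsTestFunction S (mollify (ρ n) (F n)) := by
    intro n
    have hsupp : tsupport (mollify (ρ n) (F n)) ⊆
        cthickening (δ n) ((AffineMap.homothety x₀ (s n)) ⁻¹' closure S) := by
      refine closure_minimal (fun x hx => ?_) isClosed_cthickening
      by_contra hx'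
      refine hx ?_
      have := abs_mollify_sub_le (ρ n) (hFL n).continuous (x := x) (a := 0) (B := 0)
        fun t ht => ?_
      · simpa using this
      · have ht' : ‖t‖ < r n := by simpa [hρ_def] using ht
        have : F n (x - t) = 0 := by
          refine h0 _ fun hmem => hx' ?_
          refine mem_cthickening_of_dist_le x (x - t) _ _
            (subset_closure (interior_subset hmem)) ?_
          rw [dist_eq_norm, sub_sub_cancel]
          exact ht'.le.trans (min_le_left _ _)
        simp [this]
    refine ⟨contDiff_mollify _ (hFL n).continuous, ?_, hsupp.trans (hδS n)⟩
    exact hb.isCompact_closure.of_isClosed_subset (isClosed_tsupport _)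
      ((hsupp.trans (hδS n)).trans (interior_subset.trans subset_closure))
  refine ⟨_, hasH1Grad_lineDeriv hb hf fun x hx => h0 x fun h => hx (interior_subset h),
    fun n => mollify (ρ n) (F n), htest, ?_, fun j => ?_⟩
  · refine tendsto_eLpNorm_two_zero (B := B + B) (fun n => ?_) (fun n => ?_) ?_
    · exact (hf.continuous.sub (htest n).smooth.continuous).aestronglyMeasurable
    · refine Eventually.of_forall fun x => (abs_sub _ _).trans (add_le_add (hB x) ?_)
      have := abs_mollify_sub_le (ρ n) (hFL n).continuous (x := x) (a := 0) (B := B)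
        fun t ht => by simpa using hB _
      simpa using this
    · refine Eventually.of_forall fun x => ?_
      rw [Metric.tendsto_atTop']
      intro ε hε
      have hη : 0 < ε / (2 * (L + 1)) := by positivity
      obtain ⟨N, hN⟩ := eventually_atTop.1 (hnear x _ hη)
      refine ⟨N, fun n hn => ?_⟩
      have := abs_mollify_sub_le (ρ n) (hFL n).continuous (x := x) (a := f x) (B := ε / 2)
        fun t ht => ?_
      · rw [dist_zero_right, Real.norm_eq_abs, abs_sub_comm]
        linarith
      · have h1 := hf.dist_le_mul (AffineMap.homothety x₀ (s n) (x - t)) x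
        have h2 := (mem_ball.1 (hN n hn.le t ht)).le
        rw [Real.dist_eq] at h1
        refine h1.trans ((mul_le_mul_of_nonneg_left h2 L.coe_nonneg).trans ?_)
        rw [mul_div_assoc', div_le_div_iff₀ (by positivity) (by positivity)]
        nlinarith [L.coe_nonneg]
  · refine tendsto_eLpNorm_two_zero
      (B := L * ‖(EuclideanSpace.single j 1 : Space d)‖ +
        2 * L * ‖(EuclideanSpace.single j 1 : Space d)‖) (fun n => ?_) (fun n => ?_) ?_
    · refine ((measurable_lineDeriv hf.continuous).aestronglyMeasurable).sub ?_
      have := (htest n).smooth.continuous_fderiv (by simp)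
      exact Continuous.aestronglyMeasurable (by unfold partialDeriv; fun_prop)
    · refine Eventually.of_forall fun x => (abs_sub _ _).trans (add_le_add ?_ ?_)
      · exact norm_lineDeriv_le_of_lipschitz ℝ hf
      · have := norm_fderiv_le_of_lipschitz ℝ (lipschitzWith_mollify (ρ n) (hFL n)) (x₀ := x)
        exact (ContinuousLinearMap.le_opNorm _ _).trans
          (mul_le_mul_of_nonneg_right (by simpa using this) (norm_nonneg _))
    · filter_upwards [hd] with x ⟨A, hA⟩
      have hlim : Tendsto (fun n => fderiv ℝ (mollify (ρ n) (F n)) x - s n • A) atTop (𝓝 0) := by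
        rw [Metric.tendsto_atTop']
        intro ε hε
        have h1 := hA.isLittleO.def (show (0 : ℝ) < ε / 4 by positivity)
        obtain ⟨η, hη, hball⟩ := Metric.eventually_nhds_iff_ball.1 h1
        obtain ⟨N, hN⟩ := eventually_atTop.1 (hnear x (η / 2) (by positivity))
        refine ⟨N, fun n hn => ?_⟩
        have := norm_fderiv_mollify_sub_le (ρ n) hf (x := x) (x₀ := x₀)
          (zero_le_one.trans (hs1 n).le) (show 0 ≤ ε / 4 by positivity)
          (fun y hy z hz => hball (y, z) (by
            rw [← ball_prod_same]; exact ⟨hy, hz⟩)) (hN n hn.le)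
        rw [dist_zero_right]
        nlinarith [hs2 n]
      have hlim2 : Tendsto (fun n => fderiv ℝ (mollify (ρ n) (F n)) x) atTop (𝓝 A) := by
        have := hlim.add (hslim.smul_const A)
        simpa using this
      have hlim3 : Tendsto (fun n => partialDeriv j (mollify (ρ n) (F n)) x) atTop
          (𝓝 (A (EuclideanSpace.single j 1))) :=
        ((ContinuousLinearMap.apply ℝ ℝ (EuclideanSpace.single j (1 : ℝ))).continuous.tendsto A).comp
          hlim2
      have e : lineDeriv ℝ f x (EuclideanSpace.single j 1) = A (EuclideanSpace.single j 1) := by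
        rw [hA.hasFDerivAt.differentiableAt.lineDeriv_eq_fderiv, hA.hasFDerivAt.fderiv]
      simpa [e] using hlim3.const_sub (lineDeriv ℝ f x (EuclideanSpace.single j 1))

/-! ### Simplices and barycentric coordinates -/

/-- Affine bases of `ℝ^d`; their convex hulls are the nondegenerate closed `d`-simplices. -/
abbrev SimplexBasis (d : ℕ) : Type := AffineBasis (Fin (d + 1)) ℝ (Space d)

/-- The closed simplex spanned by an affine basis. -/
def hull (b : SimplexBasis d) : Set (Space d) := convexHull ℝ (range b)

/-- The constant gradient of the `j`-th barycentric coordinate. -/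
noncomputable def coordGrad (b : SimplexBasis d) (j : Fin (d + 1)) : Space d →L[ℝ] ℝ :=
  LinearMap.toContinuousLinearMap (b.coord j).linear

theorem coordGrad_sub (b : SimplexBasis d) (j : Fin (d + 1)) (x y : Space d) :
    coordGrad b j (x - y) = b.coord j x - b.coord j y := by
  simpa [coordGrad] using (b.coord j).linearMap_vsub x y

theorem coord_eq_coordGrad_add (b : SimplexBasis d) (j : Fin (d + 1)) (x : Space d) :
    b.coord j x = coordGrad b j x + b.coord j 0 := by
  have := coordGrad_sub b j x 0
  rw [sub_zero] at this
  linarith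

theorem hasStrictFDerivAt_coord (b : SimplexBasis d) (j : Fin (d + 1)) (x : Space d) :
    HasStrictFDerivAt (b.coord j) (coordGrad b j) x := by
  have : (b.coord j : Space d → ℝ) = fun x => coordGrad b j x + b.coord j 0 :=
    funext (coord_eq_coordGrad_add b j)
  rw [this]
  exact (coordGrad b j).hasStrictFDerivAt.add_const _

theorem lipschitzWith_coord (b : SimplexBasis d) (j : Fin (d + 1)) :
    LipschitzWith ‖coordGrad b j‖₊ (b.coord j) := by
  refine LipschitzWith.of_dist_le_mul fun x y => ?_
  rw [Real.dist_eq, ← coordGrad_sub, dist_eq_norm]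
  exact (coordGrad b j).le_opNorm _

theorem sum_coord (b : SimplexBasis d) (x : Space d) : ∑ i, b.coord i x = 1 :=
  b.sum_coord_apply_eq_one x

theorem sum_mul_coord {ι : Type*} [Fintype ι] (b : SimplexBasis d) (j : Fin (d + 1)) (w : ι → ℝ)
    (y : ι → Space d) : ∑ i, w i * b.coord j (y i)
      = coordGrad b j (∑ i, w i • y i) + (∑ i, w i) * b.coord j 0 := by
  rw [map_sum, Finset.sum_mul, ← Finset.sum_add_distrib]
  refine Finset.sum_congr rfl fun i _ => ?_
  rw [coord_eq_coordGrad_add b j (y i), map_smul, smul_eq_mul]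
  ring

theorem coord_eq_sum (b b' : SimplexBasis d) (j : Fin (d + 1)) (x : Space d) :
    b.coord j x = ∑ i, b'.coord i x * b.coord j (b' i) := by
  rw [sum_mul_coord, sum_coord, one_mul, b'.linear_combination_coord_eq_self,
    ← coord_eq_coordGrad_add]

theorem mem_hull (b : SimplexBasis d) {x : Space d} : x ∈ hull b ↔ ∀ i, 0 ≤ b.coord i x := by
  rw [hull, b.convexHull_eq_nonneg_coord]; rfl

theorem mem_interior_hull (b : SimplexBasis d) {x : Space d} :
    x ∈ interior (hull b) ↔ ∀ i, 0 < b.coord i x := by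
  rw [hull, b.interior_convexHull]; rfl

theorem coord_le_one (b : SimplexBasis d) {x : Space d} (hx : x ∈ hull b) (j : Fin (d + 1)) :
    b.coord j x ≤ 1 := by
  rw [← sum_coord b x]
  exact Finset.single_le_sum (f := fun i => b.coord i x)
    (fun i _ => (mem_hull b).1 hx i) (Finset.mem_univ j)

theorem vertex_mem_hull (b : SimplexBasis d) (i : Fin (d + 1)) : b i ∈ hull b :=
  subset_convexHull _ _ (mem_range_self i)

theorem convex_hull (b : SimplexBasis d) : Convex ℝ (hull b) := convex_convexHull _ _

theorem isCompact_hull (b : SimplexBasis d) : IsCompact (hull b) :=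
  (finite_range b).isCompact_convexHull (𝕜 := ℝ)

theorem isBounded_hull (b : SimplexBasis d) : Bornology.IsBounded (hull b) :=
  (isCompact_hull b).isBounded

theorem volume_hull_lt_top (b : SimplexBasis d) : volume (hull b) < ⊤ :=
  (isCompact_hull b).measure_lt_top

theorem interior_hull_nonempty (b : SimplexBasis d) : (interior (hull b)).Nonempty :=
  ⟨_, b.centroid_mem_interior_convexHull⟩

theorem volume_hull_pos (b : SimplexBasis d) : 0 < volume (hull b) :=
  (isOpen_interior.measure_pos _ (interior_hull_nonempty b)).trans_le
    (measure_mono interior_subset)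

theorem real_volume_hull_pos (b : SimplexBasis d) : 0 < volume.real (hull b) :=
  ENNReal.toReal_pos (volume_hull_pos b).ne' (volume_hull_lt_top b).ne

theorem ae_mem_interior_hull (b : SimplexBasis d) :
    ∀ᵐ x ∂volume, x ∈ hull b → x ∈ interior (hull b) := by
  have h : volume (frontier (hull b)) = 0 := (convex_hull b).addHaar_frontier volume
  filter_upwards [measure_eq_zero_iff_ae_notMem.1 h] with x hx hxb
  by_contra hxi
  exact hx ⟨subset_closure hxb, hxi⟩

/-! ### Inscribed balls -/

/-- A barycentric coordinate varies by at most one across an inscribed ball. -/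
theorem norm_coordGrad_mul_le_one (b : SimplexBasis d) (j : Fin (d + 1)) {c : Space d} {r : ℝ}
    (hr : 0 ≤ r) (h : closedBall c r ⊆ hull b) : ‖coordGrad b j‖ * (2 * r) ≤ 1 := by
  rcases hr.eq_or_lt with rfl | hr0
  · simp
  have : ‖coordGrad b j‖ ≤ 1 / (2 * r) := by
    refine ContinuousLinearMap.opNorm_le_bound _ (by positivity) fun u => ?_
    rcases eq_or_ne u 0 with rfl | hu
    · simp
    have hu' : 0 < ‖u‖ := norm_pos_iff.2 hu
    have hm : ∀ σ : ℝ, |σ| = r / ‖u‖ → c + σ • u ∈ hull b := by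
      intro σ hσ
      refine h ?_
      rw [mem_closedBall, dist_eq_norm, add_sub_cancel_left, norm_smul, Real.norm_eq_abs, hσ,
        div_mul_cancel₀ _ hu'.ne']
    have hp := hm (r / ‖u‖) (abs_of_nonneg (by positivity))
    have hq := hm (-(r / ‖u‖)) (by rw [abs_neg, abs_of_nonneg (by positivity)])
    have e : coordGrad b j ((c + (r / ‖u‖) • u) - (c + (-(r / ‖u‖)) • u))
        = (2 * r / ‖u‖) * coordGrad b j u := by
      rw [show (c + (r / ‖u‖) • u) - (c + (-(r / ‖u‖)) • u) = (2 * r / ‖u‖) • u by module,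
        map_smul, smul_eq_mul]
    rw [coordGrad_sub] at e
    have h1 : |(2 * r / ‖u‖) * coordGrad b j u| ≤ 1 := by
      rw [← e, abs_le]
      have := coord_le_one b hp j
      have := coord_le_one b hq j
      have := (mem_hull b).1 hp j
      have := (mem_hull b).1 hq j
      constructor <;> linarith
    rw [abs_mul, abs_of_pos (by positivity), div_mul_eq_mul_div, div_le_one hu'] at h1
    rw [Real.norm_eq_abs, div_mul_eq_mul_div, le_div_iff₀ (by positivity)]
    linarith
  rwa [le_div_iff₀ (by positivity)] at this

theorem norm_coordGrad_mul_inballDiam_le_one (b : SimplexBasis d) (j : Fin (d + 1)) :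
    ‖coordGrad b j‖ * inballDiam (hull b) ≤ 1 := by
  rcases (norm_nonneg (coordGrad b j)).eq_or_lt with h | h
  · rw [← h, zero_mul]; exact zero_le_one
  · rw [mul_comm, ← le_div_iff₀ h]
    refine Real.sSup_le ?_ (by positivity)
    rintro _ ⟨c, r, hr, hball, rfl⟩
    rw [le_div_iff₀ h, mul_comm]
    exact norm_coordGrad_mul_le_one b j hr hball

theorem inballDiam_le_dist (b : SimplexBasis d) {i j : Fin (d + 1)} (hij : i ≠ j) :
    inballDiam (hull b) ≤ dist (b i) (b j) := by
  have h1 : (1 : ℝ) ≤ ‖coordGrad b i‖ * dist (b i) (b j) := by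
    have h := (coordGrad b i).le_opNorm (b i - b j)
    rw [coordGrad_sub, b.coord_apply_eq, b.coord_apply_ne hij, sub_zero, norm_one] at h
    rwa [dist_eq_norm]
  have h2 := norm_coordGrad_mul_inballDiam_le_one b i
  by_contra! hlt
  have hpos : 0 < ‖coordGrad b i‖ := by
    by_contra! h0
    have : ‖coordGrad b i‖ = 0 := le_antisymm h0 (norm_nonneg _)
    rw [this] at h1
    linarith
  nlinarith [mul_lt_mul_of_pos_left hlt hpos]

theorem exists_closedBall_subset_hull (hd : 1 ≤ d) (b : SimplexBasis d) :
    0 < inballDiam (hull b) ∧ ∃ (c : Space d) (r : ℝ), 0 < r ∧ closedBall c r ⊆ hull b ∧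
      inballDiam (hull b) ≤ 4 * r := by
  obtain ⟨d, rfl⟩ := Nat.exists_eq_add_of_le' hd
  have hpos : 0 < ‖coordGrad b 0‖ := by
    rw [norm_pos_iff]
    intro h
    have := coordGrad_sub b 0 (b 0) (b 1)
    rw [b.coord_apply_eq, b.coord_apply_ne (by simp), h] at this
    simp at this
  have hbdd : BddAbove {δ : ℝ | ∃ (c : Space (d + 1)) (r : ℝ),
      0 ≤ r ∧ closedBall c r ⊆ hull b ∧ δ = 2 * r} := by
    refine ⟨1 / ‖coordGrad b 0‖, ?_⟩
    rintro _ ⟨c, r, hr, hball, rfl⟩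
    rw [le_div_iff₀ hpos, mul_comm]
    exact norm_coordGrad_mul_le_one b 0 hr hball
  obtain ⟨x, hx⟩ := interior_hull_nonempty b
  obtain ⟨ε, hε, hball⟩ := nhds_basis_closedBall.mem_iff.1 (mem_interior_iff_mem_nhds.1 hx)
  have hmem : 2 * ε ∈ {δ : ℝ | ∃ (c : Space (d + 1)) (r : ℝ),
      0 ≤ r ∧ closedBall c r ⊆ hull b ∧ δ = 2 * r} := ⟨x, ε, hε.le, hball, rfl⟩
  have h0 : 0 < inballDiam (hull b) := lt_of_lt_of_le (by positivity) (le_csSup hbdd hmem)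
  refine ⟨h0, ?_⟩
  obtain ⟨_, ⟨c, r, hr, hc, rfl⟩, hlt⟩ :=
    exists_lt_of_lt_csSup ⟨_, hmem⟩ (show inballDiam (hull b) / 2 < inballDiam (hull b) by linarith)
  exact ⟨c, r, by linarith, hc, by linarith⟩

/-! ### The split of a simplex at an interior point -/

theorem coord_update (b : SimplexBasis d) (x₀ : Space d) (l i j : Fin (d + 1)) :
    b.coord j (Function.update b l x₀ i) =
      if i = l then b.coord j x₀ else if j = i then 1 else 0 := by
  by_cases h : i = l
  · subst h; simp
  · simp [h, b.coord_apply]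

theorem affineIndependent_update (b : SimplexBasis d) {x₀ : Space d} {l : Fin (d + 1)}
    (h : 0 < b.coord l x₀) : AffineIndependent ℝ (Function.update b l x₀) := by
  rw [affineIndependent_iff_of_fintype]
  intro w hw hw'
  rw [Finset.weightedVSub_eq_linear_combination _ hw] at hw'
  have key : ∀ j, ∑ i, w i * b.coord j (Function.update b l x₀ i) = 0 := by
    intro j
    rw [sum_mul_coord, hw', hw]; simp
  simp only [coord_update] at key
  have key2 : ∀ j, (if j = l then 0 else w j) + w l * b.coord j x₀ = 0 := by
    intro j
    refine Eq.trans ?_ (key j)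
    rw [← Finset.add_sum_erase _ _ (Finset.mem_univ l), if_pos rfl, add_comm]
    congr 1
    rw [Finset.sum_congr rfl (g := fun i => if j = i then w i else 0)
      (fun i hi => by simp [Finset.ne_of_mem_erase hi])]
    simp [Finset.sum_ite_eq, ite_not]
  have hl : w l = 0 := by
    have := key2 l
    rw [if_pos rfl, zero_add] at this
    exact (mul_eq_zero.1 this).resolve_right h.ne'
  intro i
  by_cases hi : i = l
  · rw [hi, hl]
  · have := key2 i
    rwa [if_neg hi, hl, zero_mul, add_zero] at this

/-- The cell of the split at `x₀` opposite to the `l`-th vertex: `x₀` takes the place of that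
vertex. -/
noncomputable def cell (b : SimplexBasis d) (x₀ : Space d) (h : ∀ i, 0 < b.coord i x₀)
    (l : Fin (d + 1)) : SimplexBasis d where
  toFun := Function.update b l x₀
  ind' := affineIndependent_update b (h l)
  tot' := by
    rw [(affineIndependent_update b (h l)).affineSpan_eq_top_iff_card_eq_finrank_add_one]
    simp

section Split

variable (b : SimplexBasis d) (x₀ : Space d) (h : ∀ i, 0 < b.coord i x₀)

theorem cell_apply (l i : Fin (d + 1)) : cell b x₀ h l i = Function.update b l x₀ i := rfl

theorem coord_cell (l j : Fin (d + 1)) (x : Space d) :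
    b.coord j x = (if j = l then 0 else (cell b x₀ h l).coord j x)
      + b.coord j x₀ * (cell b x₀ h l).coord l x := by
  rw [coord_eq_sum b (cell b x₀ h l)]
  simp only [cell_apply, coord_update]
  rw [← Finset.add_sum_erase _ _ (Finset.mem_univ l), if_pos rfl, add_comm, mul_comm]
  congr 1
  rw [Finset.sum_congr rfl (g := fun i => if j = i then (cell b x₀ h l).coord i x else 0)
    (fun i hi => by simp [Finset.ne_of_mem_erase hi])]
  simp [Finset.sum_ite_eq, ite_not]

theorem coord_cell_self (l : Fin (d + 1)) (x : Space d) :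
    (cell b x₀ h l).coord l x = b.coord l x / b.coord l x₀ := by
  rw [eq_div_iff (h l).ne', coord_cell b x₀ h l l x]
  simp [mul_comm]

theorem coord_cell_of_ne {l j : Fin (d + 1)} (hj : j ≠ l) (x : Space d) :
    (cell b x₀ h l).coord j x = b.coord j x - b.coord j x₀ * (b.coord l x / b.coord l x₀) := by
  rw [← coord_cell_self b x₀ h, coord_cell b x₀ h l j x, if_neg hj]
  ring

/-- The piecewise affine function on the split which is `1` at `x₀` and `0` at the vertices of the
simplex, extended by zero. -/
noncomputable def apexHat (x : Space d) : ℝ :=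
  max 0 (Finset.univ.inf' Finset.univ_nonempty fun i => b.coord i x / b.coord i x₀)

/-- On the simplex this is the piecewise affine function on the split which is `1` at the `j`-th
vertex and `0` at `x₀` and the other vertices; it is truncated to take values in `[0, 1]`
everywhere. -/
noncomputable def vertexHat (j : Fin (d + 1)) (x : Space d) : ℝ :=
  max 0 (min 1 (b.coord j x - b.coord j x₀ * apexHat b x₀ x))

variable {b x₀}

include h

theorem coord_nonneg_of_mem_cell {l : Fin (d + 1)} {x : Space d} (hx : x ∈ hull (cell b x₀ h l))
    (j : Fin (d + 1)) : 0 ≤ b.coord j x := by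
  have hm := (mem_hull _).1 hx
  rw [coord_cell b x₀ h l j x]
  have := mul_nonneg (h j).le (hm l)
  split_ifs
  · linarith
  · linarith [hm j]

theorem hull_cell_subset (l : Fin (d + 1)) : hull (cell b x₀ h l) ⊆ hull b := fun _ hx =>
  (mem_hull b).2 (coord_nonneg_of_mem_cell h hx)

theorem apexHat_of_mem_cell {l : Fin (d + 1)} {x : Space d} (hx : x ∈ hull (cell b x₀ h l)) :
    apexHat b x₀ x = (cell b x₀ h l).coord l x := by
  have hm := (mem_hull _).1 hx
  have : (Finset.univ.inf' Finset.univ_nonempty fun i => b.coord i x / b.coord i x₀)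
      = (cell b x₀ h l).coord l x := by
    refine le_antisymm ?_ (Finset.le_inf' _ _ fun j _ => ?_)
    · rw [coord_cell_self]
      exact Finset.inf'_le (fun i => b.coord i x / b.coord i x₀) (Finset.mem_univ l)
    · rw [le_div_iff₀ (h j), coord_cell b x₀ h l j x, mul_comm]
      split_ifs
      · linarith
      · linarith [hm j]
  rw [apexHat, this, max_eq_right (hm l)]

theorem vertexHat_self_of_mem_cell {l : Fin (d + 1)} {x : Space d}
    (hx : x ∈ hull (cell b x₀ h l)) : vertexHat b x₀ l x = 0 := by
  rw [vertexHat, apexHat_of_mem_cell h hx, coord_cell b x₀ h l l x]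
  simp

theorem vertexHat_of_mem_cell {l j : Fin (d + 1)} (hj : j ≠ l) {x : Space d}
    (hx : x ∈ hull (cell b x₀ h l)) : vertexHat b x₀ j x = (cell b x₀ h l).coord j x := by
  rw [vertexHat, apexHat_of_mem_cell h hx, coord_cell b x₀ h l j x, if_neg hj, add_sub_cancel_right,
    min_eq_right (coord_le_one _ hx j), max_eq_right ((mem_hull _).1 hx j)]

theorem exists_mem_cell {x : Space d} (hx : x ∈ hull b) : ∃ l, x ∈ hull (cell b x₀ h l) := by
  obtain ⟨l, -, hl⟩ := Finset.exists_mem_eq_inf' Finset.univ_nonempty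
    fun i => b.coord i x / b.coord i x₀
  refine ⟨l, (mem_hull _).2 fun j => ?_⟩
  by_cases hj : j = l
  · rw [hj, coord_cell_self]
    exact div_nonneg ((mem_hull b).1 hx l) (h l).le
  · rw [coord_cell_of_ne b x₀ h hj, sub_nonneg, ← hl, mul_comm, ← le_div_iff₀ (h j)]
    exact Finset.inf'_le (fun i => b.coord i x / b.coord i x₀) (Finset.mem_univ j)

theorem apexHat_eq_zero {x : Space d} (hx : x ∉ interior (hull b)) : apexHat b x₀ x = 0 := by
  rw [mem_interior_hull] at hx
  push Not at hx
  obtain ⟨i, hi⟩ := hx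
  refine max_eq_left ((Finset.inf'_le _ (Finset.mem_univ i)).trans ?_)
  exact div_nonpos_of_nonpos_of_nonneg hi (h i).le

theorem apexHat_pos {x : Space d} (hx : x ∈ interior (hull b)) : 0 < apexHat b x₀ x := by
  rw [mem_interior_hull] at hx
  refine lt_max_of_lt_right ((Finset.lt_inf'_iff _).2 fun i _ => div_pos (hx i) (h i))

theorem apexHat_mem_Icc {x : Space d} : apexHat b x₀ x ∈ Icc (0 : ℝ) 1 := by
  refine ⟨le_max_left _ _, ?_⟩
  by_cases hx : x ∈ interior (hull b)
  · obtain ⟨l, hl⟩ := exists_mem_cell h (interior_subset hx)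
    rw [apexHat_of_mem_cell h hl]
    exact coord_le_one _ hl l
  · rw [apexHat_eq_zero h hx]; exact zero_le_one

omit h in
theorem vertexHat_mem_Icc {j : Fin (d + 1)} {x : Space d} : vertexHat b x₀ j x ∈ Icc (0 : ℝ) 1 :=
  ⟨le_max_left _ _, max_le zero_le_one (min_le_left _ _)⟩

theorem exists_lipschitzWith_apexHat : ∃ L : ℝ≥0, LipschitzWith L (apexHat b x₀) := by
  have h1 : ∃ L : ℝ≥0, LipschitzWith L
      (Finset.univ.inf' Finset.univ_nonempty fun i x => b.coord i x / b.coord i x₀) := by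
    refine Finset.inf'_induction _ _ (p := fun f : Space d → ℝ => ∃ L : ℝ≥0, LipschitzWith L f)
      ?_ fun i _ => ⟨‖coordGrad (cell b x₀ h i) i‖₊, ?_⟩
    · rintro f ⟨L, hf⟩ g ⟨L', hg⟩
      exact ⟨_, hf.min hg⟩
    · simp only [← coord_cell_self b x₀ h]
      exact lipschitzWith_coord _ _
  obtain ⟨L, hL⟩ := h1
  refine ⟨L, ?_⟩
  have h2 := hL.const_max 0
  refine (funext fun x => ?_ : apexHat b x₀ = _) ▸ h2
  rw [apexHat, Finset.inf'_apply]

theorem exists_lipschitzWith_vertexHat (j : Fin (d + 1)) :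
    ∃ L : ℝ≥0, LipschitzWith L (vertexHat b x₀ j) := by
  obtain ⟨L, hL⟩ := exists_lipschitzWith_apexHat h
  have h1 : LipschitzWith ‖b.coord j x₀‖₊ fun y : ℝ => b.coord j x₀ * y :=
    LipschitzWith.of_dist_le_mul fun y z => by
      rw [Real.dist_eq, Real.dist_eq, ← mul_sub, abs_mul]; rfl
  exact ⟨_, (((lipschitzWith_coord b j).sub (h1.comp hL)).const_min 1).const_max 0⟩

/-! ### Consequences of shape regularity -/

theorem diam_hull_le (hd : 2 ≤ d) {γ : ℝ} (hγ : 1 ≤ γ)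
    (hs : ∀ l, diam (hull (cell b x₀ h l)) ≤ γ * inballDiam (hull (cell b x₀ h l)))
    (l : Fin (d + 1)) : diam (hull b) ≤ γ ^ 2 * inballDiam (hull (cell b x₀ h l)) := by
  have hthird : ∀ a c : Fin (d + 1), ∃ m, m ≠ a ∧ m ≠ c := by
    intro a c
    have : ({a, c} : Finset (Fin (d + 1))).card < (Finset.univ : Finset (Fin (d + 1))).card := by
      refine Finset.card_le_two.trans_lt ?_
      rw [Finset.card_univ, Fintype.card_fin]; omega
    obtain ⟨m, -, hm⟩ := Finset.exists_mem_notMem_of_card_lt_card this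
    simp only [Finset.mem_insert, Finset.mem_singleton, not_or] at hm
    exact ⟨m, hm⟩
  have hpos : ∀ m, 0 < inballDiam (hull (cell b x₀ h m)) := fun m =>
    (exists_closedBall_subset_hull (by omega) _).1
  have hcmp : ∀ m, inballDiam (hull (cell b x₀ h m))
      ≤ γ * inballDiam (hull (cell b x₀ h l)) := by
    intro m
    by_cases hml : m = l
    · subst hml; nlinarith [hpos m]
    obtain ⟨j, hjm, hjl⟩ := hthird m l
    refine (inballDiam_le_dist (cell b x₀ h m) hjm).trans (le_trans ?_ (hs l))
    have e1 : cell b x₀ h m j = cell b x₀ h l j := by simp [cell_apply, hjm, hjl]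
    have e2 : cell b x₀ h m m = cell b x₀ h l l := by simp [cell_apply]
    rw [e1, e2]
    exact dist_le_diam_of_mem (isBounded_hull _) (vertex_mem_hull _ _) (vertex_mem_hull _ _)
  rw [hull, convexHull_diam]
  refine diam_le_of_forall_dist_le (by have := hpos l; positivity) ?_
  rintro _ ⟨a, rfl⟩ _ ⟨c, rfl⟩
  obtain ⟨m, hma, hmc⟩ := hthird a c
  have e1 : b a = cell b x₀ h m a := by simp [cell_apply, hma.symm]
  have e2 : b c = cell b x₀ h m c := by simp [cell_apply, hmc.symm]
  rw [e1, e2]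
  refine (dist_le_diam_of_mem (isBounded_hull _) (vertex_mem_hull _ _)
    (vertex_mem_hull _ _)).trans ((hs m).trans ?_)
  have := mul_le_mul_of_nonneg_left (hcmp m) (zero_le_one.trans hγ)
  rw [pow_two, mul_assoc]
  exact this

theorem volume_hull_le (hd : 2 ≤ d) {D : ℝ} (hD : 0 < D) (l : Fin (d + 1))
    (hl : diam (hull b) ≤ D * inballDiam (hull (cell b x₀ h l))) :
    volume.real (hull b) ≤ (4 * D) ^ d * volume.real (hull (cell b x₀ h l)) := by
  obtain ⟨-, c, r, hr, hc, hle⟩ := exists_closedBall_subset_hull (by omega) (cell b x₀ h l)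
  have hx₀ : x₀ ∈ hull b := (mem_hull b).2 fun i => (h i).le
  have h1 : hull b ⊆ closedBall x₀ (4 * D * r) := fun y hy => by
    rw [mem_closedBall]
    refine (dist_le_diam_of_mem (isBounded_hull b) hy hx₀).trans (hl.trans ?_)
    have := mul_le_mul_of_nonneg_left hle hD.le
    linarith
  have h2 : volume.real (closedBall x₀ (4 * D * r))
      = (4 * D) ^ d * volume.real (closedBall c r) := by
    simp only [Measure.real]
    rw [Measure.addHaar_closedBall _ _ (by positivity), Measure.addHaar_closedBall _ _ hr.le,
      ENNReal.toReal_mul, ENNReal.toReal_mul, ENNReal.toReal_ofReal (by positivity),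
      ENNReal.toReal_ofReal (by positivity), finrank_euclideanSpace_fin, mul_pow]
    ring
  calc volume.real (hull b) ≤ volume.real (closedBall x₀ (4 * D * r)) :=
        measureReal_mono h1 measure_closedBall_lt_top.ne
    _ = (4 * D) ^ d * volume.real (closedBall c r) := h2
    _ ≤ _ := by
        exact mul_le_mul_of_nonneg_left (measureReal_mono hc (volume_hull_lt_top _).ne)
          (by positivity)

end Split

/-! ### Polynomials in barycentric coordinates -/

/-- The product of barycentric coordinates indexed by `a`: a homogeneous monomial of degree `m`. -/
noncomputable def baryMonomial {m : ℕ} (b : SimplexBasis d) (a : Fin m → Fin (d + 1)) :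
    Space d → ℝ := fun x => ∏ r, b.coord (a r) x

/-- The functions on `ℝ^d` that are homogeneous polynomials of degree `m` in the barycentric
coordinates. -/
noncomputable def barySpan (b : SimplexBasis d) (m : ℕ) : Submodule ℝ (Space d → ℝ) :=
  Submodule.span ℝ (range (baryMonomial (m := m) b))

theorem coord_mul_mem_barySpan (b : SimplexBasis d) {m : ℕ} (i : Fin (d + 1)) {f : Space d → ℝ}
    (hf : f ∈ barySpan b m) : (fun x => b.coord i x * f x) ∈ barySpan b (m + 1) := by
  induction hf using Submodule.span_induction with
  | mem f hf =>
    obtain ⟨a, rfl⟩ := hf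
    refine Submodule.subset_span ⟨Fin.cons i a, ?_⟩
    ext x
    simp [baryMonomial, Fin.prod_univ_succ]
  | zero =>
    convert Submodule.zero_mem _ using 1
    ext x; simp
  | add f g _ _ hf hg =>
    convert Submodule.add_mem _ hf hg using 1
    ext x; simp [mul_add]
  | smul c f _ hf =>
    convert Submodule.smul_mem _ c hf using 1
    ext x; simp [mul_left_comm]

theorem sum_coord_mul_mem_barySpan (b : SimplexBasis d) {m : ℕ} (g : Fin (d + 1) → ℝ)
    {f : Space d → ℝ} (hf : f ∈ barySpan b m) :
    (fun x => (∑ i, b.coord i x * g i) * f x) ∈ barySpan b (m + 1) := by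
  have := Submodule.sum_mem (barySpan b (m + 1)) (t := Finset.univ) fun i _ =>
    Submodule.smul_mem _ (g i) (coord_mul_mem_barySpan b i hf)
  convert this using 1
  ext x
  simp only [Finset.sum_apply, Pi.smul_apply, smul_eq_mul, Finset.sum_mul]
  exact Finset.sum_congr rfl fun i _ => by ring

theorem one_mem_barySpan (b : SimplexBasis d) (m : ℕ) : (fun _ => (1 : ℝ)) ∈ barySpan b m := by
  induction m with
  | zero => exact Submodule.subset_span ⟨Fin.elim0, by ext x; simp [baryMonomial]⟩
  | succ m ih =>
    convert sum_coord_mul_mem_barySpan b (fun _ => 1) ih using 1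
    ext x; simp [sum_coord b x]

theorem list_prod_mem_barySpan (b : SimplexBasis d) (L : List (Fin d)) {m : ℕ}
    (hm : L.length ≤ m) : (fun x : Space d => (L.map fun j => x j).prod) ∈ barySpan b m := by
  induction L generalizing m with
  | nil => simpa using one_mem_barySpan b m
  | cons j L ih =>
    obtain ⟨m, rfl⟩ : ∃ n, m = n + 1 := ⟨m - 1, by simp at hm; omega⟩
    convert sum_coord_mul_mem_barySpan b (fun i => b i j) (ih (by simpa using hm)) using 1
    ext x
    rw [List.map_cons, List.prod_cons]
    congr 1
    have := congrArg (EuclideanSpace.proj (𝕜 := ℝ) j) (b.linear_combination_coord_eq_self x)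
    rw [map_sum] at this
    simpa only [map_smul, smul_eq_mul, PiLp.proj_apply] using this.symm

theorem eval_mem_barySpan (b : SimplexBasis d) {m : ℕ} (q : MvPolynomial (Fin d) ℝ)
    (hq : q.totalDegree ≤ m) :
    (fun x : Space d => MvPolynomial.eval (fun j => x j) q) ∈ barySpan b m := by
  have h : (fun x : Space d => MvPolynomial.eval (fun j => x j) q)
      = ∑ s ∈ q.support, q.coeff s •
        fun x : Space d => ((Finsupp.toMultiset s).toList.map fun j => x j).prod := by
    ext x
    rw [MvPolynomial.eval_eq, Finset.sum_apply]
    refine Finset.sum_congr rfl fun s _ => ?_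
    rw [Pi.smul_apply, smul_eq_mul]
    congr 1
    rw [← Multiset.prod_coe, ← Multiset.map_coe, Multiset.coe_toList, Finsupp.toMultiset_map,
      Finsupp.prod_toMultiset, Finsupp.prod_mapDomain_index (by simp) (by simp [pow_add])]
    rfl
  rw [h]
  refine Submodule.sum_mem _ fun s hs => Submodule.smul_mem _ _ (list_prod_mem_barySpan b _ ?_)
  rw [Multiset.length_toList, Finsupp.card_toMultiset]
  exact (MvPolynomial.le_totalDegree hs).trans hq

theorem exists_eval_eq_sum_baryMonomial (b : SimplexBasis d) {m : ℕ} (q : MvPolynomial (Fin d) ℝ)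
    (hq : q.totalDegree ≤ m) : ∃ c : (Fin m → Fin (d + 1)) → ℝ, ∀ x : Space d,
      MvPolynomial.eval (fun j => x j) q = ∑ a, c a * baryMonomial b a x := by
  obtain ⟨c, hc⟩ := (Submodule.mem_span_range_iff_exists_fun ℝ).1 (eval_mem_barySpan b q hq)
  refine ⟨c, fun x => ?_⟩
  rw [← congrFun hc x]
  simp

theorem continuous_baryMonomial {m : ℕ} (b : SimplexBasis d) (a : Fin m → Fin (d + 1)) :
    Continuous (baryMonomial b a) :=
  continuous_finsetProd _ fun r _ => (lipschitzWith_coord b (a r)).continuous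

theorem continuous_sum_baryMonomial {m : ℕ} (b : SimplexBasis d)
    (c : (Fin m → Fin (d + 1)) → ℝ) : Continuous fun x => ∑ a, c a * baryMonomial b a x :=
  continuous_finsetSum _ fun a _ => continuous_const.mul (continuous_baryMonomial b a)

/-- On a fixed simplex, a homogeneous polynomial in the barycentric coordinates has coefficients
controlled by its `L²` norm: the synthesis map from coefficients to `L²` has finite-dimensional
range, hence a bounded right inverse. -/
theorem exists_coeff_le_l2Norm (b : SimplexBasis d) (m : ℕ) : ∃ C : ℝ, 0 < C ∧
    ∀ c : (Fin m → Fin (d + 1)) → ℝ, ∃ c' : (Fin m → Fin (d + 1)) → ℝ,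
      (∀ x ∈ interior (hull b), ∑ a, c' a * baryMonomial b a x = ∑ a, c a * baryMonomial b a x) ∧
      ∀ a, |c' a| ≤ C * l2Norm (hull b) fun x => ∑ a, c a * baryMonomial b a x := by
  have hfin : IsFiniteMeasure (volume.restrict (hull b)) := ⟨by
    rw [Measure.restrict_apply_univ]; exact volume_hull_lt_top b⟩
  have hmem : ∀ g : Space d → ℝ, Continuous g → MemLp g 2 (volume.restrict (hull b)) := by
    intro g hg
    obtain ⟨B, hB⟩ := (isCompact_hull b).exists_bound_of_continuousOn hg.continuousOn
    exact MemLp.of_bound hg.aestronglyMeasurable B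
      ((ae_restrict_iff' (isCompact_hull b).measurableSet).2 (Eventually.of_forall hB))
  let T : ((Fin m → Fin (d + 1)) → ℝ) →ₗ[ℝ] Lp ℝ 2 (volume.restrict (hull b)) :=
    Fintype.linearCombination ℝ fun a => (hmem _ (continuous_baryMonomial b a)).toLp
  have hT : ∀ c, T c = (hmem _ (continuous_sum_baryMonomial b c)).toLp := by
    intro c
    refine Lp.ext ?_
    have h1 : T c = ∑ a, c a • (hmem _ (continuous_baryMonomial b a)).toLp :=
      Fintype.linearCombination_apply ..
    rw [h1]
    have h2 : ∀ᵐ x ∂volume.restrict (hull b), ∀ a,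
        (c a • (hmem _ (continuous_baryMonomial b a)).toLp : Lp ℝ 2 _) x
          = c a * baryMonomial b a x := by
      refine ae_all_iff.2 fun a => ?_
      filter_upwards [Lp.coeFn_smul (c a) (hmem _ (continuous_baryMonomial b a)).toLp,
        (hmem _ (continuous_baryMonomial b a)).coeFn_toLp] with x hx hx'
      rw [hx, Pi.smul_apply, hx', smul_eq_mul]
    filter_upwards [h2, (hmem _ (continuous_sum_baryMonomial b c)).coeFn_toLp,
      Lp.coeFn_finsetSum Finset.univ
        fun a => c a • (hmem _ (continuous_baryMonomial b a)).toLp] with x hx hx' hx''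
    rw [hx', hx'', Finset.sum_apply]
    exact Finset.sum_congr rfl fun a _ => hx a
  have hnorm : ∀ c, ‖T c‖ = l2Norm (hull b) fun x => ∑ a, c a * baryMonomial b a x := by
    intro c
    rw [l2Norm, eq_comm, Real.sqrt_eq_iff_mul_self_eq (by positivity) (norm_nonneg _),
      ← pow_two, ← real_inner_self_eq_norm_sq, hT, L2.inner_def]
    refine integral_congr_ae ?_
    filter_upwards [(hmem _ (continuous_sum_baryMonomial b c)).coeFn_toLp] with x hx
    rw [hx]
    simp [pow_two]
  obtain ⟨g, hg⟩ := T.rangeRestrict.exists_rightInverse_of_surjective T.range_rangeRestrict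
  let G := LinearMap.toContinuousLinearMap g
  refine ⟨‖G‖ + 1, by positivity, fun c => ⟨g (T.rangeRestrict c), ?_, fun a => ?_⟩⟩
  · have h1 : T (g (T.rangeRestrict c)) = T c :=
      congrArg Subtype.val (LinearMap.congr_fun hg (T.rangeRestrict c))
    rw [hT, hT, MemLp.toLp_eq_toLp_iff] at h1
    exact Measure.eqOn_open_of_ae_eq (ae_restrict_of_ae_restrict_of_subset interior_subset h1)
      isOpen_interior (continuous_sum_baryMonomial b _).continuousOn
      (continuous_sum_baryMonomial b c).continuousOn
  · have h1 : ‖G (T.rangeRestrict c)‖ ≤ ‖G‖ * ‖T c‖ := G.le_opNorm _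
    have h2 := (norm_le_pi_norm (G (T.rangeRestrict c)) a).trans h1
    rw [hnorm, Real.norm_eq_abs] at h2
    have h3 : 0 ≤ l2Norm (hull b) fun x => ∑ a, c a * baryMonomial b a x := Real.sqrt_nonneg _
    calc _ ≤ _ := h2
      _ ≤ _ := by nlinarith

/-- The affine map taking the vertices of `b` to those of `b'`. -/
noncomputable def transport (b b' : SimplexBasis d) (x : Space d) : Space d :=
  ∑ i, b.coord i x • b' i

theorem coord_transport (b b' : SimplexBasis d) (j : Fin (d + 1)) (x : Space d) :
    b'.coord j (transport b b' x) = b.coord j x := by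
  have h1 : b'.coord j (transport b b' x) = ∑ i, b.coord i x * b'.coord j (b' i) := by
    rw [sum_mul_coord, sum_coord, one_mul, coord_eq_coordGrad_add b' j, transport]
  rw [h1]
  simp [b'.coord_apply]

theorem transport_transport (b b' : SimplexBasis d) (x : Space d) :
    transport b' b (transport b b' x) = x :=
  b.ext_elem fun i => by rw [coord_transport, coord_transport]

theorem image_transport_hull (b b' : SimplexBasis d) :
    transport b b' '' hull b = hull b' := by
  ext y
  constructor
  · rintro ⟨x, hx, rfl⟩
    rw [mem_hull] at hx ⊢
    simpa [coord_transport] using hx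
  · intro hy
    refine ⟨transport b' b y, ?_, transport_transport b' b y⟩
    rw [mem_hull] at hy ⊢
    simpa [coord_transport] using hy

theorem baryMonomial_transport {m : ℕ} (b b' : SimplexBasis d) (a : Fin m → Fin (d + 1))
    (x : Space d) : baryMonomial b' a (transport b b' x) = baryMonomial b a x := by
  simp [baryMonomial, coord_transport]

/-- Affine transport between simplices multiplies all integrals by the same factor. -/
theorem exists_integral_hull_eq (b b' : SimplexBasis d) : ∃ D : ℝ, 0 ≤ D ∧
    ∀ g : Space d → ℝ, ∫ x in hull b', g x = D * ∫ x in hull b, g (transport b b' x) := by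
  let A : Space d →L[ℝ] Space d := ∑ i, (coordGrad b i).smulRight (b' i)
  have hA : ∀ x ∈ hull b, HasFDerivWithinAt (transport b b') A (hull b) x := by
    intro x _
    refine HasFDerivAt.hasFDerivWithinAt ?_
    exact HasFDerivAt.fun_sum fun i _ =>
      (hasStrictFDerivAt_coord b i x).hasFDerivAt.smul_const (b' i)
  refine ⟨|A.det|, abs_nonneg _, fun g => ?_⟩
  have hinj : InjOn (transport b b') (hull b) :=
    (Function.LeftInverse.injective (transport_transport b b')).injOn
  rw [← image_transport_hull b b', integral_image_eq_integral_abs_det_fderiv_smul volume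
    (isCompact_hull b).measurableSet hA hinj]
  simp only [smul_eq_mul, integral_const_mul]

/-- A polynomial of degree at most `m` is a homogeneous polynomial of degree `m` in the barycentric
coordinates of any simplex, with coefficients bounded by its root mean square on the simplex;
the constant does not depend on the simplex, since all simplices are affinely equivalent. -/
theorem exists_baryMonomial_expansion (d m : ℕ) : ∃ C : ℝ, 0 < C ∧
    ∀ (b : SimplexBasis d) (q : MvPolynomial (Fin d) ℝ), q.totalDegree ≤ m →
      ∃ c : (Fin m → Fin (d + 1)) → ℝ,
        (∀ x ∈ interior (hull b),
          MvPolynomial.eval (fun j => x j) q = ∑ a, c a * baryMonomial b a x) ∧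
        ∀ a, |c a| * √(volume.real (hull b))
          ≤ C * l2Norm (hull b) fun x => MvPolynomial.eval (fun j => x j) q := by
  obtain ⟨b₀⟩ : Nonempty (SimplexBasis d) :=
    AffineBasis.exists_affineBasis_of_finiteDimensional (by simp)
  obtain ⟨C, hC, hb₀⟩ := exists_coeff_le_l2Norm b₀ m
  refine ⟨C * √(volume.real (hull b₀)),
    mul_pos hC (Real.sqrt_pos.2 (real_volume_hull_pos b₀)), fun b q hq => ?_⟩
  obtain ⟨c, hc⟩ := exists_eval_eq_sum_baryMonomial b q hq
  obtain ⟨c', hc', hbd⟩ := hb₀ c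
  obtain ⟨D, hD, hint⟩ := exists_integral_hull_eq b₀ b
  have hvol : volume.real (hull b) = D * volume.real (hull b₀) := by
    simpa using hint fun _ => 1
  have hl2 : l2Norm (hull b) (fun x => MvPolynomial.eval (fun j => x j) q)
      = √D * l2Norm (hull b₀) fun x => ∑ a, c a * baryMonomial b₀ a x := by
    rw [l2Norm, hint, Real.sqrt_mul hD, l2Norm]
    simp only [hc, baryMonomial_transport]
  refine ⟨c', fun x hx => ?_, fun a => ?_⟩
  · have hx' : transport b b₀ x ∈ interior (hull b₀) := by
      rw [mem_interior_hull] at hx ⊢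
      simpa [coord_transport] using hx
    have := hc' _ hx'
    simp only [baryMonomial_transport] at this
    rw [hc, this]
  · rw [hvol, hl2, Real.sqrt_mul hD]
    have := mul_le_mul_of_nonneg_right (hbd a)
      (show 0 ≤ √D * √(volume.real (hull b₀)) by positivity)
    linarith

/-! ### Monomials in the hat functions -/

theorem exists_totalDegree_le_one_eval_eq_coord (b : SimplexBasis d) (j : Fin (d + 1)) :
    ∃ q : MvPolynomial (Fin d) ℝ, q.totalDegree ≤ 1 ∧
      ∀ x : Space d, MvPolynomial.eval (fun i => x i) q = b.coord j x := by
  refine ⟨MvPolynomial.C (b.coord j 0)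
    + ∑ i, MvPolynomial.C (coordGrad b j (EuclideanSpace.single i 1)) * MvPolynomial.X i, ?_, ?_⟩
  · refine (MvPolynomial.totalDegree_add _ _).trans (max_le (by simp) ?_)
    refine MvPolynomial.totalDegree_finsetSum_le fun i _ => ?_
    refine (MvPolynomial.totalDegree_mul _ _).trans ?_
    rw [MvPolynomial.totalDegree_C, MvPolynomial.totalDegree_X]
  · intro x
    rw [coord_eq_coordGrad_add b j x, add_comm]
    conv_rhs => rw [← (EuclideanSpace.basisFun (Fin d) ℝ).sum_repr x, map_sum]
    simp [mul_comm]

theorem contDiff_eval (q : MvPolynomial (Fin d) ℝ) :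
    ContDiff ℝ ∞ fun x : Space d => MvPolynomial.eval (fun j => x j) q := by
  have h := AnalyticOnNhd.eval_continuousLinearMap'
    (fun j => (EuclideanSpace.proj j : Space d →L[ℝ] ℝ)) q
  exact contDiff_iff_contDiffAt.2 fun x => (h x (mem_univ x)).contDiffAt

theorem exists_lipschitzWith_mul {f g : Space d → ℝ} (hf : ∃ L : ℝ≥0, LipschitzWith L f)
    (hg : ∃ L : ℝ≥0, LipschitzWith L g) (hf1 : ∀ x, |f x| ≤ 1) (hg1 : ∀ x, |g x| ≤ 1) :
    ∃ L : ℝ≥0, LipschitzWith L fun x => f x * g x := by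
  obtain ⟨L, hL⟩ := hf
  obtain ⟨L', hL'⟩ := hg
  refine ⟨L' + L, LipschitzWith.of_dist_le_mul fun x y => ?_⟩
  have h1 := hL.dist_le_mul x y
  have h2 := hL'.dist_le_mul x y
  rw [Real.dist_eq] at h1 h2 ⊢
  have e : f x * g x - f y * g y = f x * (g x - g y) + (f x - f y) * g y := by ring
  rw [e]
  refine (abs_add_le _ _).trans ?_
  rw [abs_mul, abs_mul]
  push_cast
  nlinarith [mul_le_mul (hf1 x) h2 (abs_nonneg _) zero_le_one,
    mul_le_mul h1 (hg1 y) (abs_nonneg _) (by positivity)]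

/-- The product of the `n`-th power of the apex hat function and the vertex hat functions indexed
by `a r`, for `r ∈ s`. -/
noncomputable def hatMonomial {m : ℕ} (b : SimplexBasis d) (x₀ : Space d) (n : ℕ)
    (a : Fin m → Fin (d + 1)) (s : Finset (Fin m)) (x : Space d) : ℝ :=
  apexHat b x₀ x ^ n * ∏ r ∈ s, vertexHat b x₀ (a r) x

section HatMonomial

variable {b : SimplexBasis d} {x₀ : Space d} (h : ∀ i, 0 < b.coord i x₀)
  {m : ℕ} (a : Fin m → Fin (d + 1)) (s : Finset (Fin m))

theorem prod_vertexHat_mem_Icc (x : Space d) :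
    ∏ r ∈ s, vertexHat b x₀ (a r) x ∈ Icc (0 : ℝ) 1 :=
  ⟨Finset.prod_nonneg fun _ _ => vertexHat_mem_Icc.1,
    Finset.prod_le_one (fun _ _ => vertexHat_mem_Icc.1) fun _ _ => vertexHat_mem_Icc.2⟩

/-- The gradient of the `j`-th vertex hat function on the `l`-th cell. -/
noncomputable def vertexHatGrad (l j : Fin (d + 1)) : Space d →L[ℝ] ℝ :=
  if j = l then 0 else coordGrad (cell b x₀ h l) j

include h

theorem hatMonomial_mem_Icc (n : ℕ) (x : Space d) :
    hatMonomial b x₀ n a s x ∈ Icc (0 : ℝ) 1 := by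
  have h1 := apexHat_mem_Icc h (x := x)
  have h2 := prod_vertexHat_mem_Icc (b := b) (x₀ := x₀) a s x
  exact ⟨mul_nonneg (pow_nonneg h1.1 _) h2.1, mul_le_one₀ (pow_le_one₀ h1.1 h1.2) h2.1 h2.2⟩

theorem exists_lipschitzWith_hatMonomial (n : ℕ) :
    ∃ L : ℝ≥0, LipschitzWith L (hatMonomial b x₀ n a s) := by
  have h1 : ∀ x, |apexHat b x₀ x| ≤ 1 := fun x => by
    rw [abs_of_nonneg (apexHat_mem_Icc h).1]; exact (apexHat_mem_Icc h).2
  have h2 : ∀ j x, |vertexHat b x₀ j x| ≤ 1 := fun j x => by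
    rw [abs_of_nonneg vertexHat_mem_Icc.1]; exact vertexHat_mem_Icc.2
  have h3 : ∀ n : ℕ, ∃ L : ℝ≥0, LipschitzWith L fun x => apexHat b x₀ x ^ n := by
    intro n
    induction n with
    | zero => exact ⟨0, by simp⟩
    | succ n ih =>
      simp only [pow_succ]
      refine exists_lipschitzWith_mul ih (exists_lipschitzWith_apexHat h) (fun x => ?_) h1
      rw [abs_pow]
      exact pow_le_one₀ (abs_nonneg _) (h1 x)
  have h4 : ∃ L : ℝ≥0, LipschitzWith L fun x => ∏ r ∈ s, vertexHat b x₀ (a r) x := by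
    induction s using Finset.induction_on with
    | empty => exact ⟨0, by simp⟩
    | insert r s hr ih =>
      simp only [Finset.prod_insert hr]
      refine exists_lipschitzWith_mul (exists_lipschitzWith_vertexHat h _) ih (h2 _) fun x => ?_
      rw [Finset.abs_prod]
      exact Finset.prod_le_one (fun _ _ => abs_nonneg _) fun r _ => h2 _ x
  refine exists_lipschitzWith_mul (h3 n) h4 (fun x => ?_) fun x => ?_
  · rw [abs_pow]
    exact pow_le_one₀ (abs_nonneg _) (h1 x)
  · rw [Finset.abs_prod]
    exact Finset.prod_le_one (fun _ _ => abs_nonneg _) fun r _ => h2 _ x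

theorem exists_eval_eq_hatMonomial {n : ℕ} (hn : n + s.card ≤ m + 1) (l : Fin (d + 1)) :
    ∃ q : MvPolynomial (Fin d) ℝ, q.totalDegree ≤ m + 1 ∧ ∀ x ∈ hull (cell b x₀ h l),
      hatMonomial b x₀ n a s x = MvPolynomial.eval (fun i => x i) q := by
  choose Q hQ1 hQ2 using exists_totalDegree_le_one_eval_eq_coord (cell b x₀ h l)
  refine ⟨Q l ^ n * ∏ r ∈ s, (if a r = l then 0 else Q (a r)), ?_, fun x hx => ?_⟩
  · refine (MvPolynomial.totalDegree_mul _ _).trans (le_trans (add_le_add ?_ ?_) hn)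
    · exact (MvPolynomial.totalDegree_pow _ _).trans (by simpa using Nat.mul_le_mul_left n (hQ1 l))
    · refine (MvPolynomial.totalDegree_finsetProd _ _).trans ?_
      refine (Finset.sum_le_sum (g := fun _ => 1) fun r _ => ?_).trans (by simp)
      split_ifs
      · simp
      · exact hQ1 _
  · rw [hatMonomial, apexHat_of_mem_cell h hx, map_mul, map_pow, hQ2, map_prod]
    congr 1
    refine Finset.prod_congr rfl fun r _ => ?_
    split_ifs with hr
    · rw [hr, vertexHat_self_of_mem_cell h hx, map_zero]
    · rw [vertexHat_of_mem_cell h hr hx, hQ2]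

theorem hasFDerivAt_hatMonomial (n : ℕ) {l : Fin (d + 1)} {x : Space d}
    (hx : x ∈ interior (hull (cell b x₀ h l))) :
    HasFDerivAt (hatMonomial b x₀ n a s)
      (apexHat b x₀ x ^ n • (∑ r ∈ s, (∏ r' ∈ s.erase r, vertexHat b x₀ (a r') x) •
          vertexHatGrad h l (a r))
        + (∏ r ∈ s, vertexHat b x₀ (a r) x) •
          ((n * apexHat b x₀ x ^ (n - 1)) • coordGrad (cell b x₀ h l) l)) x := by
  have hnhds := mem_interior_iff_mem_nhds.1 hx
  have h1 : HasFDerivAt (apexHat b x₀) (coordGrad (cell b x₀ h l) l) x := by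
    refine (hasStrictFDerivAt_coord (cell b x₀ h l) l x).hasFDerivAt.congr_of_eventuallyEq ?_
    filter_upwards [hnhds] with y hy using apexHat_of_mem_cell h hy
  have h2 : ∀ j, HasFDerivAt (vertexHat b x₀ j) (vertexHatGrad h l j) x := by
    intro j
    unfold vertexHatGrad
    split_ifs with hj
    · refine (hasFDerivAt_const (0 : ℝ) x).congr_of_eventuallyEq ?_
      filter_upwards [hnhds] with y hy
      rw [hj, vertexHat_self_of_mem_cell h hy]
    · refine (hasStrictFDerivAt_coord (cell b x₀ h l) j x).hasFDerivAt.congr_of_eventuallyEq ?_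
      filter_upwards [hnhds] with y hy using vertexHat_of_mem_cell h hj hy
  have h3 := HasFDerivAt.finsetProd (u := s) (g := fun r => vertexHat b x₀ (a r))
    fun r _ => h2 (a r)
  have h4 := (h1.pow n).mul h3
  simp only [← nsmul_eq_mul]
  exact h4

end HatMonomial

/-! ### Solving the divergence equation -/

/-- `v` is a continuous piecewise polynomial field of degree at most `m + 1` on the split of the
simplex `b` at `x₀`, vanishing outside; on the `l`-th cell its divergence is `p l`, up to the
multiple `σ` of the `m`-th power of the apex hat function. The values and gradients of the components
are bounded by `C` times the diameter and by `C`, respectively. -/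
structure SolvesDiv (b : SimplexBasis d) (x₀ : Space d) (h : ∀ i, 0 < b.coord i x₀) (m : ℕ)
    (C : ℝ) (v : Fin d → Space d → ℝ) (σ : ℝ) (p : Fin (d + 1) → Space d → ℝ) : Prop where
  lipschitz : ∀ j, ∃ L : ℝ≥0, LipschitzWith L (v j)
  eq_zero : ∀ j, ∀ x ∉ interior (hull b), v j x = 0
  poly : ∀ j l, ∃ q : MvPolynomial (Fin d) ℝ, q.totalDegree ≤ m + 1 ∧
    ∀ x ∈ hull (cell b x₀ h l), v j x = MvPolynomial.eval (fun i => x i) q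
  abs_le : ∀ j x, |v j x| ≤ C * diam (hull b)
  norm_fderiv_le : ∀ j l, ∀ x ∈ interior (hull (cell b x₀ h l)), ‖fderiv ℝ (v j) x‖ ≤ C
  div_eq : ∀ l, ∀ x ∈ interior (hull (cell b x₀ h l)),
    ∑ j, fderiv ℝ (v j) x (EuclideanSpace.single j 1) = p l x - σ * apexHat b x₀ x ^ m

section SolvesDiv

variable {b : SimplexBasis d} {x₀ : Space d} {h : ∀ i, 0 < b.coord i x₀} {m : ℕ} {C C' σ σ' : ℝ}
  {v v' : Fin d → Space d → ℝ} {p p' : Fin (d + 1) → Space d → ℝ}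

theorem SolvesDiv.exists_hasStrictFDerivAt (hv : SolvesDiv b x₀ h m C v σ p) (j : Fin d)
    {l : Fin (d + 1)} {x : Space d} (hx : x ∈ interior (hull (cell b x₀ h l))) :
    ∃ A : Space d →L[ℝ] ℝ, HasStrictFDerivAt (v j) A x := by
  obtain ⟨q, -, hq⟩ := hv.poly j l
  refine ⟨_, (((contDiff_eval q).contDiffAt.hasStrictFDerivAt (by simp)).congr_of_eventuallyEq ?_)⟩
  filter_upwards [mem_interior_iff_mem_nhds.1 hx] with y hy using (hq y hy).symm

theorem SolvesDiv.differentiableAt (hv : SolvesDiv b x₀ h m C v σ p) (j : Fin d)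
    {l : Fin (d + 1)} {x : Space d} (hx : x ∈ interior (hull (cell b x₀ h l))) :
    DifferentiableAt ℝ (v j) x :=
  (hv.exists_hasStrictFDerivAt j hx).choose_spec.hasFDerivAt.differentiableAt

theorem SolvesDiv.add (hv : SolvesDiv b x₀ h m C v σ p) (hv' : SolvesDiv b x₀ h m C' v' σ' p') :
    SolvesDiv b x₀ h m (C + C') (fun j x => v j x + v' j x) (σ + σ')
      (fun l x => p l x + p' l x) where
  lipschitz j := by
    obtain ⟨L, hL⟩ := hv.lipschitz j
    obtain ⟨L', hL'⟩ := hv'.lipschitz j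
    exact ⟨_, hL.add hL'⟩
  eq_zero j x hx := by rw [hv.eq_zero j x hx, hv'.eq_zero j x hx, add_zero]
  poly j l := by
    obtain ⟨q, hq1, hq2⟩ := hv.poly j l
    obtain ⟨q', hq1', hq2'⟩ := hv'.poly j l
    refine ⟨q + q', (MvPolynomial.totalDegree_add _ _).trans (max_le hq1 hq1'), fun x hx => ?_⟩
    rw [hq2 x hx, hq2' x hx, map_add]
  abs_le j x := by
    rw [add_mul]
    exact (abs_add_le _ _).trans (add_le_add (hv.abs_le j x) (hv'.abs_le j x))
  norm_fderiv_le j l x hx := by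
    rw [fderiv_fun_add (hv.differentiableAt j hx) (hv'.differentiableAt j hx)]
    exact (norm_add_le _ _).trans
      (add_le_add (hv.norm_fderiv_le j l x hx) (hv'.norm_fderiv_le j l x hx))
  div_eq l x hx := by
    have : ∀ j, fderiv ℝ (fun x => v j x + v' j x) x = fderiv ℝ (v j) x + fderiv ℝ (v' j) x :=
      fun j => fderiv_fun_add (hv.differentiableAt j hx) (hv'.differentiableAt j hx)
    simp only [this, add_apply, Finset.sum_add_distrib, hv.div_eq l x hx, hv'.div_eq l x hx]
    ring

theorem SolvesDiv.const_mul (hv : SolvesDiv b x₀ h m C v σ p) (c : ℝ) :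
    SolvesDiv b x₀ h m (|c| * C) (fun j x => c * v j x) (c * σ) (fun l x => c * p l x) where
  lipschitz j := by
    obtain ⟨L, hL⟩ := hv.lipschitz j
    refine ⟨‖c‖₊ * L, LipschitzWith.of_dist_le_mul fun x y => ?_⟩
    rw [Real.dist_eq, ← mul_sub, abs_mul, ← Real.dist_eq]
    have := mul_le_mul_of_nonneg_left (hL.dist_le_mul x y) (abs_nonneg c)
    simpa [mul_assoc] using this
  eq_zero j x hx := by rw [hv.eq_zero j x hx, mul_zero]
  poly j l := by
    obtain ⟨q, hq1, hq2⟩ := hv.poly j l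
    refine ⟨MvPolynomial.C c * q, (MvPolynomial.totalDegree_mul _ _).trans (by simpa using hq1),
      fun x hx => ?_⟩
    rw [hq2 x hx, map_mul, MvPolynomial.eval_C]
  abs_le j x := by
    rw [abs_mul, mul_assoc]
    exact mul_le_mul_of_nonneg_left (hv.abs_le j x) (abs_nonneg c)
  norm_fderiv_le j l x hx := by
    rw [fderiv_const_mul (hv.differentiableAt j hx), norm_smul]
    exact mul_le_mul_of_nonneg_left (hv.norm_fderiv_le j l x hx) (abs_nonneg c)
  div_eq l x hx := by
    have : ∀ j, fderiv ℝ (fun x => c * v j x) x = c • fderiv ℝ (v j) x :=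
      fun j => fderiv_const_mul (hv.differentiableAt j hx) c
    simp only [this, smul_apply, smul_eq_mul, ← Finset.mul_sum, hv.div_eq l x hx]
    ring

/-- The pressure `p` is a divergence up to a multiple of a power of the apex hat function, with
bounds as in `SolvesDiv`. -/
def Solvable (b : SimplexBasis d) (x₀ : Space d) (h : ∀ i, 0 < b.coord i x₀) (m : ℕ)
    (C : ℝ) (p : Fin (d + 1) → Space d → ℝ) : Prop :=
  ∃ v σ, SolvesDiv b x₀ h m C v σ p

theorem Solvable.add (hp : Solvable b x₀ h m C p) (hp' : Solvable b x₀ h m C' p') :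
    Solvable b x₀ h m (C + C') (fun l x => p l x + p' l x) := by
  obtain ⟨v, σ, hv⟩ := hp
  obtain ⟨v', σ', hv'⟩ := hp'
  exact ⟨_, _, hv.add hv'⟩

theorem Solvable.mono (hp : Solvable b x₀ h m C p) (hC : C ≤ C') :
    Solvable b x₀ h m C' p := by
  obtain ⟨v, σ, hv⟩ := hp
  exact ⟨v, σ, { hv with
    abs_le := fun j x => (hv.abs_le j x).trans (mul_le_mul_of_nonneg_right hC diam_nonneg)
    norm_fderiv_le := fun j l x hx => (hv.norm_fderiv_le j l x hx).trans hC }⟩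

theorem Solvable.const_mul (hp : Solvable b x₀ h m C p) {c B : ℝ} (hC : 0 ≤ C) (hc : |c| ≤ B) :
    Solvable b x₀ h m (B * C) (fun l x => c * p l x) := by
  obtain ⟨v, σ, hv⟩ := hp
  exact Solvable.mono ⟨_, _, hv.const_mul c⟩ (mul_le_mul_of_nonneg_right hc hC)

theorem Solvable.congr (hp : Solvable b x₀ h m C p)
    (hpp' : ∀ l, ∀ x ∈ interior (hull (cell b x₀ h l)), p' l x = p l x) :
    Solvable b x₀ h m C p' := by
  obtain ⟨v, σ, hv⟩ := hp
  exact ⟨v, σ, { hv with div_eq := fun l x hx => by rw [hpp' l x hx, hv.div_eq l x hx] }⟩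

theorem solvable_zero : Solvable b x₀ h m 0 fun _ _ => 0 :=
  ⟨fun _ _ => 0, 0,
    { lipschitz := fun _ => ⟨0, LipschitzWith.const 0⟩
      eq_zero := fun _ _ _ => rfl
      poly := fun _ _ => ⟨0, by simp, by simp⟩
      abs_le := by simp
      norm_fderiv_le := by simp
      div_eq := by simp }⟩

theorem Solvable.sum {ι : Type*} (u : Finset ι) {P : ι → Fin (d + 1) → Space d → ℝ}
    (hP : ∀ i ∈ u, Solvable b x₀ h m C (P i)) :
    Solvable b x₀ h m (u.card * C) (fun l x => ∑ i ∈ u, P i l x) := by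
  classical
  induction u using Finset.induction_on with
  | empty => simpa using solvable_zero
  | insert i u hi ih =>
    have := (hP i (Finset.mem_insert_self i u)).add
      (ih fun j hj => hP j (Finset.mem_insert_of_mem hj))
    refine (this.mono (le_of_eq ?_)).congr fun l x _ => Finset.sum_insert hi
    rw [Finset.card_insert_of_notMem hi]
    push_cast
    ring

theorem sum_mul_single (A : Space d →L[ℝ] ℝ) (w : Space d) :
    ∑ j, w j * A (EuclideanSpace.single j 1) = A w := by
  conv_rhs => rw [← (EuclideanSpace.basisFun (Fin d) ℝ).sum_repr w, map_sum]
  simp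

/-- The field `hatMonomial • w`, with constant `w`. -/
theorem solvable_hatMonomial {D : ℝ}
    (hD : ∀ l j, ‖coordGrad (cell b x₀ h l) j‖ * diam (hull b) ≤ D)
    (a : Fin m → Fin (d + 1)) (s : Finset (Fin m)) {n : ℕ} (hn : 1 ≤ n)
    (hns : n + s.card ≤ m + 1) {w : Space d} (hw : ‖w‖ ≤ diam (hull b)) :
    Solvable b x₀ h m (1 + (m + 1) * D) fun l x =>
      apexHat b x₀ x ^ n * (∑ r ∈ s, (∏ r' ∈ s.erase r, vertexHat b x₀ (a r') x) *
          vertexHatGrad h l (a r) w)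
        + (∏ r ∈ s, vertexHat b x₀ (a r) x) *
          (n * apexHat b x₀ x ^ (n - 1) * coordGrad (cell b x₀ h l) l w) := by
  have hD0 : 0 ≤ D := (mul_nonneg (norm_nonneg _) diam_nonneg).trans (hD 0 0)
  have hwj : ∀ j, |w j| ≤ ‖w‖ := fun j => by
    simpa using PiLp.norm_apply_le w j
  have hmD : 0 ≤ (m + 1) * D := by positivity
  refine ⟨fun j x => w j * hatMonomial b x₀ n a s x, 0, ⟨fun j => ?_, fun j x hx => ?_,
    fun j l => ?_, fun j x => ?_, fun j l x hx => ?_, fun l x hx => ?_⟩⟩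
  · obtain ⟨L, hL⟩ := exists_lipschitzWith_hatMonomial h a s n
    refine ⟨‖w j‖₊ * L, LipschitzWith.of_dist_le_mul fun x y => ?_⟩
    rw [Real.dist_eq, ← mul_sub, abs_mul, ← Real.dist_eq]
    have := mul_le_mul_of_nonneg_left (hL.dist_le_mul x y) (abs_nonneg (w j))
    simpa [mul_assoc] using this
  · simp [hatMonomial, apexHat_eq_zero h hx, show n ≠ 0 by omega]
  · obtain ⟨q, hq1, hq2⟩ := exists_eval_eq_hatMonomial h a s hns l
    refine ⟨MvPolynomial.C (w j) * q, (MvPolynomial.totalDegree_mul _ _).trans (by simpa using hq1),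
      fun x hx => ?_⟩
    rw [hq2 x hx, map_mul, MvPolynomial.eval_C]
  · have h1 := hatMonomial_mem_Icc h a s n x
    rw [abs_mul, abs_of_nonneg h1.1]
    have h2 := (hwj j).trans hw
    have h3 : (0 : ℝ) ≤ diam (hull b) := diam_nonneg
    nlinarith [mul_le_mul h2 h1.2 h1.1 h3, mul_nonneg hmD h3]
  · have hd := hasFDerivAt_hatMonomial h a s n hx
    rw [fderiv_const_mul hd.differentiableAt, hd.fderiv, norm_smul, Real.norm_eq_abs]
    have h1 := apexHat_mem_Icc h (x := x)
    have h2 := fun s => prod_vertexHat_mem_Icc (b := b) (x₀ := x₀) a s x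
    have hv : ∀ j', ‖vertexHatGrad h l j'‖ * diam (hull b) ≤ D := by
      intro j'
      unfold vertexHatGrad
      split_ifs
      · simpa using hD0
      · exact hD l j'
    have h3 : ‖apexHat b x₀ x ^ n • (∑ r ∈ s, (∏ r' ∈ s.erase r, vertexHat b x₀ (a r') x) •
          vertexHatGrad h l (a r))‖ * diam (hull b) ≤ s.card * D := by
      rw [norm_smul, Real.norm_of_nonneg (pow_nonneg h1.1 _)]
      have h4 : ‖∑ r ∈ s, (∏ r' ∈ s.erase r, vertexHat b x₀ (a r') x) •
          vertexHatGrad h l (a r)‖ * diam (hull b) ≤ s.card * D := by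
        refine (mul_le_mul_of_nonneg_right (norm_sum_le _ _) diam_nonneg).trans ?_
        rw [Finset.sum_mul]
        refine (Finset.sum_le_card_nsmul s _ D fun r _ => ?_).trans (by simp)
        rw [norm_smul, Real.norm_of_nonneg (h2 _).1, mul_assoc]
        exact (mul_le_of_le_one_left (by positivity) (h2 _).2).trans (hv _)
      rw [mul_assoc]
      exact (mul_le_of_le_one_left (by positivity) (pow_le_one₀ h1.1 h1.2)).trans h4
    have h5 : ‖(∏ r ∈ s, vertexHat b x₀ (a r) x) •
          ((n * apexHat b x₀ x ^ (n - 1)) • coordGrad (cell b x₀ h l) l)‖ * diam (hull b)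
          ≤ n * D := by
      rw [norm_smul, norm_smul, Real.norm_of_nonneg (h2 _).1, norm_mul, norm_pow,
        Real.norm_of_nonneg h1.1, Real.norm_natCast, mul_assoc, mul_assoc, mul_assoc]
      refine (mul_le_of_le_one_left (mul_nonneg n.cast_nonneg (by have := h1.1; positivity)) (h2 _).2).trans ?_
      refine mul_le_mul_of_nonneg_left ?_ n.cast_nonneg
      exact (mul_le_of_le_one_left (by positivity) (pow_le_one₀ h1.1 h1.2)).trans (hD l l)
    have hns' : (n : ℝ) + s.card ≤ m + 1 := by exact_mod_cast hns
    calc _ ≤ diam (hull b) * _ :=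
          mul_le_mul_of_nonneg_right ((hwj j).trans hw) (norm_nonneg _)
      _ ≤ diam (hull b) * (_ + _) := mul_le_mul_of_nonneg_left (norm_add_le _ _) diam_nonneg
      _ ≤ s.card * D + n * D := by
          rw [mul_comm, add_mul]
          exact add_le_add h3 h5
      _ ≤ 1 + (m + 1) * D := by nlinarith
  · have hd := hasFDerivAt_hatMonomial h a s n hx
    have : ∀ j, fderiv ℝ (fun x => w j * hatMonomial b x₀ n a s x) x
        = w j • fderiv ℝ (hatMonomial b x₀ n a s) x :=
      fun j => fderiv_const_mul hd.differentiableAt _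
    simp only [this, smul_apply, smul_eq_mul, sum_mul_single]
    simp only [hd.fderiv, zero_mul, sub_zero, add_apply, sum_apply, smul_apply, smul_eq_mul]

end SolvesDiv

/-! ### Construction of the velocity -/

/-- The piecewise polynomial of degree `m` which on the `i`-th cell is the product of the vertex hat
functions indexed by `s` and a power of the apex hat function, and vanishes on the other cells. -/
noncomputable def cellMonomial {m : ℕ} (b : SimplexBasis d) (x₀ : Space d)
    (a : Fin m → Fin (d + 1)) (s : Finset (Fin m)) (i l : Fin (d + 1)) (x : Space d) : ℝ :=
  if l = i then hatMonomial b x₀ (m - s.card) a s x else 0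

section Construction

variable {b : SimplexBasis d} {x₀ : Space d} {h : ∀ i, 0 < b.coord i x₀} {m : ℕ}

theorem coordGrad_cell_self_sub (l : Fin (d + 1)) (y z : Space d) :
    coordGrad (cell b x₀ h l) l (y - z) = (b.coord l y - b.coord l z) / b.coord l x₀ := by
  rw [coordGrad_sub, coord_cell_self, coord_cell_self, sub_div]

include h in
theorem norm_smul_sub_le_diam {y z : Space d} (hy : y ∈ hull b) (hz : z ∈ hull b)
    (i : Fin (d + 1)) : ‖b.coord i x₀ • (y - z)‖ ≤ diam (hull b) := by
  have hx₀ : x₀ ∈ hull b := (mem_hull b).2 fun i => (h i).le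
  rw [norm_smul, Real.norm_of_nonneg (h i).le, ← dist_eq_norm]
  exact (mul_le_of_le_one_left dist_nonneg (coord_le_one b hx₀ i)).trans
    (dist_le_diam_of_mem (isBounded_hull b) hy hz)

theorem solvable_cellMonomial_empty {D : ℝ}
    (hD : ∀ l j, ‖coordGrad (cell b x₀ h l) j‖ * diam (hull b) ≤ D)
    (a : Fin m → Fin (d + 1)) (i : Fin (d + 1)) :
    Solvable b x₀ h m (1 + (m + 1) * D) (cellMonomial b x₀ a ∅ i) := by
  have hD0 : 0 ≤ D := (mul_nonneg (norm_nonneg _) diam_nonneg).trans (hD 0 0)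
  have hx₀ : x₀ ∈ hull b := (mem_hull b).2 fun i => (h i).le
  obtain ⟨v, σ, hv⟩ := solvable_hatMonomial hD a ∅ (n := m + 1) (by omega) (by simp)
    (norm_smul_sub_le_diam (h := h) (vertex_mem_hull b i) hx₀ i)
  have hm : ((m : ℝ) + 1) ≠ 0 := by positivity
  have hc : |((m : ℝ) + 1)⁻¹| ≤ 1 := by
    rw [abs_of_pos (by positivity)]
    exact inv_le_one_of_one_le₀ (by linarith [m.cast_nonneg (α := ℝ)])
  have hw := hv.const_mul ((m : ℝ) + 1)⁻¹
  -- The divergence is `cellMonomial b x₀ a ∅ i` minus `b.coord i x₀` times the `m`-th power of the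
  -- apex hat function.
  have hw' : SolvesDiv b x₀ h m _ _ (((m : ℝ) + 1)⁻¹ * σ + b.coord i x₀)
      (cellMonomial b x₀ a ∅ i) := { hw with
    div_eq := fun l x hx => by
      rw [hw.div_eq l x hx, map_smul, coordGrad_cell_self_sub, b.coord_apply, cellMonomial,
        hatMonomial]
      have := (h i).ne'
      have := (h l).ne'
      by_cases hli : l = i
      · subst hli
        simp
        field_simp
        ring
      · simp [hli]
        field_simp
        ring }
  exact Solvable.mono ⟨_, _, hw'⟩ (mul_le_of_le_one_left (by positivity) hc)

/-- The induction step. The direction from the vertex `a r₀` to the `i`-th vertex is tangential to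
all faces except those opposite to these two vertices, and on the face opposite to the vertex `a r₀`
the hat monomial vanishes. So the divergence of a multiple of the hat monomial in that direction is
`cellMonomial b x₀ a s i` plus terms with one more factor of the apex hat function and one vertex
hat function less. -/
theorem Solvable.cellMonomial_of_erase {D C : ℝ} (hC : 0 ≤ C)
    (hD : ∀ l j, ‖coordGrad (cell b x₀ h l) j‖ * diam (hull b) ≤ D)
    (a : Fin m → Fin (d + 1)) {s : Finset (Fin m)} (hs : s.Nonempty)
    (hrec : ∀ r ∈ s, ∀ l, Solvable b x₀ h m C (cellMonomial b x₀ a (s.erase r) l))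
    (i : Fin (d + 1)) :
    Solvable b x₀ h m (1 + (m + 1) * D + m * ((d + 1) * (D * C))) (cellMonomial b x₀ a s i) := by
  have hD0 : 0 ≤ D := (mul_nonneg (norm_nonneg _) diam_nonneg).trans (hD 0 0)
  have hsm : s.card ≤ m := by simpa using Finset.card_le_univ s
  have hs1 : 1 ≤ s.card := hs.card_pos
  by_cases hi : ∃ r ∈ s, a r = i
  · -- The `i`-th vertex hat function vanishes on the `i`-th cell.
    refine (solvable_zero.mono (by positivity)).congr fun l x hx => ?_
    obtain ⟨r, hr, hri⟩ := hi
    rw [cellMonomial]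
    split_ifs with hl
    · rw [hatMonomial, Finset.prod_eq_zero hr, mul_zero]
      rw [hri, ← hl]
      exact vertexHat_self_of_mem_cell h (interior_subset hx)
    · rfl
  push Not at hi
  obtain ⟨r₀, hr₀⟩ := hs
  set w : Space d := b.coord i x₀ • (b i - b (a r₀)) with hw_def
  have hw : ‖w‖ ≤ diam (hull b) :=
    norm_smul_sub_le_diam (h := h) (vertex_mem_hull b i) (vertex_mem_hull b _) i
  obtain ⟨N, hN⟩ : ∃ N, N = m - s.card := ⟨_, rfl⟩
  have hblock := solvable_hatMonomial hD a s (n := N + 1) (by omega) (by omega) hw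
  have hN0 : (0 : ℝ) < (N : ℝ) + 1 := by positivity
  have hNinv : |((N : ℝ) + 1)⁻¹| ≤ 1 := by
    rw [abs_of_pos (by positivity)]
    exact inv_le_one_of_one_le₀ (by linarith [N.cast_nonneg (α := ℝ)])
  have hgrad : ∀ l j, |vertexHatGrad h l j w| ≤ D := by
    intro l j
    unfold vertexHatGrad
    split_ifs
    · simpa using hD0
    · exact ((coordGrad (cell b x₀ h l) j).le_opNorm w).trans
        ((mul_le_mul_of_nonneg_left hw (norm_nonneg _)).trans (hD l j))
  have hrem : Solvable b x₀ h m (m * ((d + 1) * (D * C))) fun l x =>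
      ∑ r ∈ s, ∑ l', (-(((N : ℝ) + 1)⁻¹ * vertexHatGrad h l' (a r) w)) *
        cellMonomial b x₀ a (s.erase r) l' l x := by
    refine (Solvable.sum s (C := (d + 1) * (D * C)) fun r hr => ?_).mono ?_
    · refine (Solvable.sum Finset.univ (C := D * C) fun l' _ => ?_).mono (by simp)
      refine (hrec r hr l').const_mul hC ?_
      rw [abs_neg, abs_mul]
      exact (mul_le_of_le_one_left (abs_nonneg _) hNinv).trans (hgrad _ _)
    · gcongr
  refine ((hblock.const_mul (by positivity) hNinv).add hrem).mono (by rw [one_mul]) |>.congr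
    fun l x hx => ?_
  have hsingle : ∀ r ∈ s, ∑ l', (-(((N : ℝ) + 1)⁻¹ * vertexHatGrad h l' (a r) w)) *
      cellMonomial b x₀ a (s.erase r) l' l x = -(((N : ℝ) + 1)⁻¹ * (apexHat b x₀ x ^ (N + 1) *
        ((∏ r' ∈ s.erase r, vertexHat b x₀ (a r') x) * vertexHatGrad h l (a r) w))) := by
    intro r hr
    rw [Finset.sum_eq_single l (fun l' _ hl' => by simp [cellMonomial, hl'.symm]) (by simp),
      cellMonomial, if_pos rfl, hatMonomial, Finset.card_erase_of_mem hr,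
      show m - (s.card - 1) = N + 1 by omega]
    ring
  rw [Finset.sum_congr rfl hsingle, Finset.sum_neg_distrib, ← Finset.mul_sum, ← Finset.mul_sum]
  have hmain : cellMonomial b x₀ a s i l x = (∏ r ∈ s, vertexHat b x₀ (a r) x) *
      (apexHat b x₀ x ^ N * coordGrad (cell b x₀ h l) l w) := by
    rw [hw_def, map_smul, coordGrad_cell_self_sub, b.coord_apply, b.coord_apply, cellMonomial,
      hatMonomial, ← hN]
    have hir : i ≠ a r₀ := (hi r₀ hr₀).symm
    have := (h i).ne'
    by_cases hl : l = i
    · subst hl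
      simp [hir]
      field_simp
    · by_cases hl' : l = a r₀
      · rw [Finset.prod_eq_zero hr₀]
        · simp
        · rw [← hl']
          exact vertexHat_self_of_mem_cell h (interior_subset hx)
      · simp [hl, hl']
  rw [hmain]
  push_cast
  field_simp
  ring

theorem exists_solvable_cellMonomial_of_card (d m : ℕ) {D : ℝ} (hD0 : 0 ≤ D) (n : ℕ) :
    ∃ C : ℝ, 0 ≤ C ∧ ∀ (b : SimplexBasis d) (x₀ : Space d) (h : ∀ i, 0 < b.coord i x₀),
      (∀ l j, ‖coordGrad (cell b x₀ h l) j‖ * diam (hull b) ≤ D) →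
      ∀ (a : Fin m → Fin (d + 1)) (s : Finset (Fin m)), s.card = n → ∀ i,
        Solvable b x₀ h m C (cellMonomial b x₀ a s i) := by
  induction n with
  | zero =>
    refine ⟨1 + (m + 1) * D, by positivity, fun b x₀ h hD a s hs i => ?_⟩
    rw [Finset.card_eq_zero.1 hs]
    exact solvable_cellMonomial_empty hD a i
  | succ n ih =>
    obtain ⟨C, hC, hrec⟩ := ih
    refine ⟨1 + (m + 1) * D + m * ((d + 1) * (D * C)), by positivity,
      fun b x₀ h hD a s hs i => ?_⟩
    refine Solvable.cellMonomial_of_erase hC hD a (Finset.card_pos.1 (by omega))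
      (fun r hr l => hrec b x₀ h hD a _ ?_ l) i
    rw [Finset.card_erase_of_mem hr, hs, Nat.add_sub_cancel]

theorem exists_solvable_cellMonomial (d m : ℕ) {D : ℝ} (hD0 : 0 ≤ D) :
    ∃ C : ℝ, 0 ≤ C ∧ ∀ (b : SimplexBasis d) (x₀ : Space d) (h : ∀ i, 0 < b.coord i x₀),
      (∀ l j, ‖coordGrad (cell b x₀ h l) j‖ * diam (hull b) ≤ D) →
      ∀ (a : Fin m → Fin (d + 1)) (s : Finset (Fin m)) (i : Fin (d + 1)),
        Solvable b x₀ h m C (cellMonomial b x₀ a s i) := by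
  choose C hC hsolv using exists_solvable_cellMonomial_of_card d m hD0
  refine ⟨∑ n ∈ Finset.range (m + 1), C n, Finset.sum_nonneg fun n _ => hC n,
    fun b x₀ h hD a s i => (hsolv s.card b x₀ h hD a s rfl i).mono ?_⟩
  have hs : s.card ≤ m := by simpa using Finset.card_le_univ s
  exact Finset.single_le_sum (fun n _ => hC n) (Finset.mem_range.2 (by omega))

theorem baryMonomial_cell (a : Fin m → Fin (d + 1)) {l : Fin (d + 1)} {x : Space d}
    (hx : x ∈ hull (cell b x₀ h l)) : baryMonomial (cell b x₀ h l) a x =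
      cellMonomial b x₀ a (Finset.univ.filter fun r => a r ≠ l) l l x := by
  rw [cellMonomial, if_pos rfl, hatMonomial, baryMonomial,
    ← Finset.prod_filter_mul_prod_filter_not Finset.univ (fun r => a r = l)]
  congr 1
  · rw [apexHat_of_mem_cell h hx, Finset.prod_congr rfl
      (g := fun _ => (cell b x₀ h l).coord l x) fun r hr => by rw [(Finset.mem_filter.1 hr).2],
      Finset.prod_const]
    congr 1
    have := Finset.card_filter_add_card_filter_not (s := (Finset.univ : Finset (Fin m)))
      (fun r => a r = l)
    rw [Finset.card_univ, Fintype.card_fin] at this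
    simp only [ne_eq]
    omega
  · exact Finset.prod_congr rfl fun r hr =>
      (vertexHat_of_mem_cell h (Finset.mem_filter.1 hr).2 hx).symm

/-- The algebraic core: a piecewise polynomial is a divergence up to a multiple of a power of the
apex hat function, with a field bounded by the barycentric coefficients. -/
theorem exists_solvable_of_coeff_le (d m : ℕ) {D : ℝ} (hD0 : 0 ≤ D) :
    ∃ C : ℝ, 0 ≤ C ∧ ∀ (b : SimplexBasis d) (x₀ : Space d) (h : ∀ i, 0 < b.coord i x₀),
      (∀ l j, ‖coordGrad (cell b x₀ h l) j‖ * diam (hull b) ≤ D) →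
      ∀ (c : Fin (d + 1) → (Fin m → Fin (d + 1)) → ℝ) (B : ℝ), (∀ l a, |c l a| ≤ B) →
        Solvable b x₀ h m (C * B) fun l x => ∑ a, c l a * baryMonomial (cell b x₀ h l) a x := by
  obtain ⟨C, hC, hsolv⟩ := exists_solvable_cellMonomial d m hD0
  refine ⟨(d + 1 : ℕ) * (((d + 1) ^ m : ℕ) * C), by positivity, fun b x₀ h hD c B hc => ?_⟩
  have hsum : Solvable b x₀ h m ((d + 1 : ℕ) * (((d + 1) ^ m : ℕ) * (B * C))) fun l x =>
      ∑ i, ∑ a, c i a * cellMonomial b x₀ a (Finset.univ.filter fun r => a r ≠ i) i l x := by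
    refine (Solvable.sum Finset.univ (C := ((d + 1) ^ m : ℕ) * (B * C)) fun i _ => ?_).mono
      (by simp)
    refine (Solvable.sum Finset.univ (C := B * C) fun a _ => ?_).mono (by simp)
    exact (hsolv b x₀ h hD a _ i).const_mul hC (hc i a)
  refine (hsum.mono (le_of_eq (by ring))).congr fun l x hx => ?_
  rw [Finset.sum_eq_single l (fun i _ hi => by simp [cellMonomial, hi.symm]) (by simp)]
  exact Finset.sum_congr rfl fun a _ => by rw [baryMonomial_cell a (interior_subset hx)]

end Construction

/-! ### Integral estimates and the mean-value condition -/

theorem l2Norm_le_of_ae_le {S : Set (Space d)} (hS : volume S < ⊤) {u : Space d → ℝ} {B : ℝ}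
    (hB : 0 ≤ B) (hu : ∀ᵐ x ∂volume.restrict S, |u x| ≤ B) :
    l2Norm S u ≤ B * √(volume.real S) := by
  have : IsFiniteMeasure (volume.restrict S) := ⟨by rwa [Measure.restrict_apply_univ]⟩
  have h1 : ∫ x in S, u x ^ 2 ≤ B ^ 2 * volume.real S := by
    have h2 := norm_integral_le_of_norm_le_const (μ := volume.restrict S) (f := fun x => u x ^ 2)
      (C := B ^ 2) (by
        filter_upwards [hu] with x hx
        rw [Real.norm_eq_abs, abs_pow]
        exact pow_le_pow_left₀ (abs_nonneg _) hx 2)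
    rw [measureReal_restrict_apply_univ] at h2
    exact (le_abs_self _).trans h2
  refine (Real.sqrt_le_sqrt h1).trans (le_of_eq ?_)
  rw [Real.sqrt_mul (by positivity), Real.sqrt_sq hB]

theorem h1Norm_le {S : Set (Space d)} (hS : volume S < ⊤) {v : Space d → Space d}
    {G : Fin d → Fin d → Space d → ℝ} {A H : ℝ} (hA : 0 ≤ A) (hH : 0 ≤ H)
    (hv : ∀ i, ∀ᵐ x ∂volume.restrict S, |v x i| ≤ A * H)
    (hG : ∀ i j, ∀ᵐ x ∂volume.restrict S, |G i j x| ≤ A) :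
    h1Norm S v G ≤ √(d + d ^ 2) * max 1 H * (A * √(volume.real S)) := by
  have hM : 0 ≤ max 1 H := zero_le_one.trans (le_max_left _ _)
  set V := √(volume.real S) with hV
  have hV0 : 0 ≤ V := Real.sqrt_nonneg _
  have key : ∀ t : ℝ, 0 ≤ t → t ≤ max 1 H * (A * V) → t ^ 2 ≤ (max 1 H * (A * V)) ^ 2 :=
    fun t ht h => pow_le_pow_left₀ ht h 2
  have h1 : ∀ i, l2Norm S (fun x => v x i) ^ 2 ≤ (max 1 H * (A * V)) ^ 2 := fun i => by
    refine key _ (Real.sqrt_nonneg _) ((l2Norm_le_of_ae_le hS (by positivity) (hv i)).trans ?_)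
    have := mul_le_mul_of_nonneg_right (le_max_right 1 H) (mul_nonneg hA hV0)
    linarith
  have h2 : ∀ i j, l2Norm S (G i j) ^ 2 ≤ (max 1 H * (A * V)) ^ 2 := fun i j => by
    refine key _ (Real.sqrt_nonneg _) ((l2Norm_le_of_ae_le hS hA (hG i j)).trans ?_)
    exact le_mul_of_one_le_left (mul_nonneg hA hV0) (le_max_left _ _)
  have h3 : ∑ i, l2Norm S (fun x => v x i) ^ 2 + ∑ i, ∑ j, l2Norm S (G i j) ^ 2
      ≤ (d + d ^ 2) * (max 1 H * (A * V)) ^ 2 := by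
    have h4 := Finset.sum_le_sum fun i (_ : i ∈ Finset.univ) => h1 i
    have h5 := Finset.sum_le_sum fun i (_ : i ∈ Finset.univ) =>
      Finset.sum_le_sum fun j (_ : j ∈ Finset.univ) => h2 i j
    simp only [Finset.sum_const, Finset.card_univ, Fintype.card_fin, nsmul_eq_mul] at h4 h5
    linarith
  refine (Real.sqrt_le_sqrt h3).trans (le_of_eq ?_)
  rw [Real.sqrt_mul (by positivity), Real.sqrt_sq (by positivity), mul_assoc]

section Final

variable {b : SimplexBasis d} {x₀ : Space d} {h : ∀ i, 0 < b.coord i x₀} {m : ℕ} {C σ : ℝ}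
  {v : Fin d → Space d → ℝ} {p : Fin (d + 1) → Space d → ℝ}

theorem ae_exists_mem_interior_cell (b : SimplexBasis d) (x₀ : Space d)
    (h : ∀ i, 0 < b.coord i x₀) :
    ∀ᵐ x ∂volume.restrict (hull b), ∃ l, x ∈ interior (hull (cell b x₀ h l)) := by
  rw [ae_restrict_iff' (isCompact_hull b).measurableSet]
  filter_upwards [ae_all_iff.2 fun l => ae_mem_interior_hull (cell b x₀ h l)] with x hx hxb
  obtain ⟨l, hl⟩ := exists_mem_cell h hxb
  exact ⟨l, hx l hl⟩

theorem SolvesDiv.hasH1Grad (hv : SolvesDiv b x₀ h m C v σ p) (j : Fin d) :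
    HasH1Grad (hull b) (v j) fun i x => lineDeriv ℝ (v j) x (EuclideanSpace.single i 1) := by
  obtain ⟨L, hL⟩ := hv.lipschitz j
  exact hasH1Grad_lineDeriv (isBounded_hull b) hL
    fun x hx => hv.eq_zero j x fun hx' => hx (interior_subset hx')

theorem SolvesDiv.memH10 (hv : SolvesDiv b x₀ h m C v σ p) (j : Fin d) :
    MemH10 (hull b) (v j) := by
  obtain ⟨L, hL⟩ := hv.lipschitz j
  refine memH10_of_lipschitzWith (convex_hull b) (isBounded_hull b)
    ((mem_interior_hull b).2 h) hL (hv.eq_zero j) ?_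
  filter_upwards [ae_exists_mem_interior_cell b x₀ h] with x ⟨l, hl⟩
  exact hv.exists_hasStrictFDerivAt j hl

theorem SolvesDiv.integral_div (hv : SolvesDiv b x₀ h m C v σ p) :
    ∫ x in hull b, ∑ j, lineDeriv ℝ (v j) x (EuclideanSpace.single j 1) = 0 := by
  have hfin : IsFiniteMeasure (volume.restrict (hull b)) := ⟨by
    rw [Measure.restrict_apply_univ]; exact volume_hull_lt_top b⟩
  rw [integral_finsetSum _ fun j _ =>
    ((hv.hasH1Grad j).memLp_grad j).integrable (by norm_num)]
  refine Finset.sum_eq_zero fun j _ => ?_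
  obtain ⟨L, hL⟩ := hv.lipschitz j
  have h0 : ∀ x ∉ hull b, v j x = 0 := fun x hx =>
    hv.eq_zero j x fun hx' => hx (interior_subset hx')
  rw [setIntegral_eq_integral_of_forall_compl_eq_zero]
  · refine integral_lineDeriv_eq_zero hL ?_ _
    exact HasCompactSupport.of_support_subset_isCompact (isCompact_hull b) fun x hx => by
      by_contra hx'
      exact hx (h0 x hx')
  · intro x hx
    have h1 : v j =ᶠ[𝓝 x] fun _ => 0 := by
      filter_upwards [(isCompact_hull b).isClosed.isOpen_compl.mem_nhds hx] with y hy
      exact h0 y hy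
    rw [h1.lineDeriv_eq]
    simp [lineDeriv]

theorem SolvesDiv.ae_sum_lineDeriv_eq (hv : SolvesDiv b x₀ h m C v σ p) {P : Space d → ℝ}
    (hP : ∀ᵐ x ∂volume.restrict (hull b), ∀ l, x ∈ interior (hull (cell b x₀ h l)) → P x = p l x) :
    ∀ᵐ x ∂volume.restrict (hull b),
      ∑ j, lineDeriv ℝ (v j) x (EuclideanSpace.single j 1) = P x - σ * apexHat b x₀ x ^ m := by
  filter_upwards [hP, ae_exists_mem_interior_cell b x₀ h] with x hx ⟨l, hl⟩
  rw [hx l hl, ← hv.div_eq l x hl]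
  exact Finset.sum_congr rfl fun j _ => (hv.differentiableAt j hl).lineDeriv_eq_fderiv

/-- If the pressure has mean zero then so has the remaining multiple of a power of the apex hat
function, which is positive; so it is zero. -/
theorem SolvesDiv.eq_zero_of_integral_eq_zero (hv : SolvesDiv b x₀ h m C v σ p)
    {P : Space d → ℝ} (hPi : IntegrableOn P (hull b)) (hP0 : ∫ x in hull b, P x = 0)
    (hP : ∀ᵐ x ∂volume.restrict (hull b), ∀ l, x ∈ interior (hull (cell b x₀ h l)) → P x = p l x) :
    σ = 0 := by
  obtain ⟨L, hL⟩ := exists_lipschitzWith_apexHat h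
  have hcont : Continuous fun x => apexHat b x₀ x ^ m := hL.continuous.pow m
  have hint : IntegrableOn (fun x => apexHat b x₀ x ^ m) (hull b) :=
    hcont.continuousOn.integrableOn_compact (isCompact_hull b)
  have h1 := hv.integral_div
  rw [integral_congr_ae (hv.ae_sum_lineDeriv_eq hP), integral_sub hPi (hint.const_mul σ), hP0,
    integral_const_mul, zero_sub, neg_eq_zero] at h1
  refine (mul_eq_zero.1 h1).resolve_right (ne_of_gt ?_)
  rw [setIntegral_pos_iff_support_of_nonneg_ae
    (Eventually.of_forall fun x => pow_nonneg (apexHat_mem_Icc h).1 m) hint]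
  refine (isOpen_interior.measure_pos volume (interior_hull_nonempty b)).trans_le
    (measure_mono fun x hx => ⟨?_, interior_subset hx⟩)
  exact (pow_pos (apexHat_pos h hx) m).ne'

theorem SolvesDiv.abs_lineDeriv_le (hv : SolvesDiv b x₀ h m C v σ p) (i j : Fin d) :
    ∀ᵐ x ∂volume.restrict (hull b),
      |lineDeriv ℝ (v i) x (EuclideanSpace.single j 1)| ≤ C := by
  filter_upwards [ae_exists_mem_interior_cell b x₀ h] with x ⟨l, hl⟩
  rw [(hv.differentiableAt i hl).lineDeriv_eq_fderiv]
  have := (fderiv ℝ (v i) x).le_opNorm (EuclideanSpace.single j 1)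
  rw [PiLp.norm_single, norm_one, mul_one] at this
  exact this.trans (hv.norm_fderiv_le i l x hl)

end Final

/-! ### Pressures on the refinement -/

/-- The vertices of a nondegenerate simplex as an affine basis. -/
noncomputable def simplexBasis (K : Affine.Simplex ℝ (Space d) d) : SimplexBasis d where
  toFun := K.points
  ind' := K.independent
  tot' := by
    rw [K.independent.affineSpan_eq_top_iff_card_eq_finrank_add_one]
    simp

/-- A piecewise polynomial has barycentric coefficients on the cells that are bounded by its root
mean square over the whole simplex, if the volumes of the cells are comparable to that of the
simplex. -/
theorem exists_piecewise_expansion (d m : ℕ) : ∃ C : ℝ, 0 < C ∧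
    ∀ (K : Affine.Simplex ℝ (Space d) d) (x₀ : Space d)
      (h : ∀ i, 0 < (simplexBasis K).coord i x₀) (E : ℝ), 0 ≤ E →
      (∀ l, volume.real (body K) ≤ E * volume.real (hull (cell (simplexBasis K) x₀ h l))) →
      ∀ p : Space d → ℝ, MemPressure m K x₀ p →
        ∃ c : Fin (d + 1) → (Fin m → Fin (d + 1)) → ℝ,
          (∀ᵐ x ∂volume.restrict (body K), ∀ l,
            x ∈ interior (hull (cell (simplexBasis K) x₀ h l)) →
              p x = ∑ a, c l a * baryMonomial (cell (simplexBasis K) x₀ h l) a x) ∧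
          ∀ l a, |c l a| ≤ C * √E * l2Norm (body K) p / √(volume.real (body K)) := by
  obtain ⟨C, hC, hexp⟩ := exists_baryMonomial_expansion d m
  refine ⟨C, hC, fun K x₀ h E hE hvol p hp => ?_⟩
  choose q hq1 hq2 using hp.poly
  choose c hc1 hc2 using fun l => hexp (cell (simplexBasis K) x₀ h l) (q l) (hq1 l)
  have hsub : ∀ l, subcell K x₀ l ⊆ body K := fun l => hull_cell_subset h l
  refine ⟨c, ?_, fun l a => ?_⟩
  · refine ae_all_iff.2 fun l => ?_
    refine ae_restrict_of_ae ?_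
    have hm : MeasurableSet (subcell K x₀ l) :=
      (isCompact_hull (cell (simplexBasis K) x₀ h l)).measurableSet
    filter_upwards [(ae_restrict_iff' hm).1 (hq2 l)] with x hx hxl
    rw [hx (interior_subset hxl), hc1 l x hxl]
  · have hK : 0 < volume.real (body K) := real_volume_hull_pos (simplexBasis K)
    rw [le_div_iff₀ (Real.sqrt_pos.2 hK)]
    have h1 : l2Norm (subcell K x₀ l) (fun x => MvPolynomial.eval (fun j => x j) (q l))
        ≤ l2Norm (body K) p := by
      refine Real.sqrt_le_sqrt ?_
      calc ∫ x in subcell K x₀ l, MvPolynomial.eval (fun j => x j) (q l) ^ 2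
          = ∫ x in subcell K x₀ l, p x ^ 2 := by
            refine integral_congr_ae ?_
            filter_upwards [hq2 l] with x hx
            rw [hx]
        _ ≤ ∫ x in body K, p x ^ 2 :=
            setIntegral_mono_set hp.memLp.integrable_sq
              (Eventually.of_forall fun x => sq_nonneg (p x)) (hsub l).eventuallyLE
    calc |c l a| * √(volume.real (body K))
        ≤ |c l a| * (√E * √(volume.real (hull (cell (simplexBasis K) x₀ h l)))) := by
          rw [← Real.sqrt_mul hE]
          exact mul_le_mul_of_nonneg_left (Real.sqrt_le_sqrt (hvol l)) (abs_nonneg _)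
      _ = √E * (|c l a| * √(volume.real (hull (cell (simplexBasis K) x₀ h l)))) := by ring
      _ ≤ √E * (C * l2Norm (body K) p) :=
          mul_le_mul_of_nonneg_left ((hc2 l a).trans (mul_le_mul_of_nonneg_left h1 hC.le))
            (Real.sqrt_nonneg _)
      _ = C * √E * l2Norm (body K) p := by ring

end LocalInfSup

open LocalInfSup in
theorem theorem3p1 (d k : ℕ) (hd : 2 ≤ d) (hk : 1 ≤ k) (γ : ℝ) :
    ∃ C : ℝ, 0 < C ∧
      ∀ (K : Affine.Simplex ℝ (LocalInfSup.Space d) d) (x₀ : LocalInfSup.Space d),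
        x₀ ∈ interior (LocalInfSup.body K) →
        LocalInfSup.refinedShapeConst K x₀ ≤ γ →
        ∀ p : LocalInfSup.Space d → ℝ, LocalInfSup.MemPressure (k - 1) K x₀ p →
          ∃ (v : LocalInfSup.Space d → LocalInfSup.Space d)
            (G : Fin d → Fin d → LocalInfSup.Space d → ℝ),
            LocalInfSup.MemVelocity k K x₀ v ∧
            ContinuousOn v (LocalInfSup.body K) ∧
            (∀ x ∈ frontier (LocalInfSup.body K), v x = 0) ∧
            (∀ i, LocalInfSup.HasH1Grad (LocalInfSup.body K) (fun x => v x i) (G i)) ∧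
            (∀ᵐ x ∂(volume.restrict (LocalInfSup.body K)), ∑ i, G i i x = p x) ∧
            LocalInfSup.h1Norm (LocalInfSup.body K) v G ≤
              C * max 1 (Metric.diam (LocalInfSup.body K)) *
                LocalInfSup.l2Norm (LocalInfSup.body K) p := by
  obtain ⟨m, rfl⟩ : ∃ m, k = m + 1 := ⟨k - 1, by omega⟩
  rw [Nat.add_sub_cancel]
  set g : ℝ := max γ 1 with hg
  have hg1 : 1 ≤ g := le_max_right _ _
  set D : ℝ := g ^ 2 with hD_def
  have hD0 : 0 < D := by positivity
  obtain ⟨C₁, hC₁, hexp⟩ := exists_piecewise_expansion d m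
  obtain ⟨C₀, hC₀, hsolv⟩ := exists_solvable_of_coeff_le d m hD0.le
  set E : ℝ := (4 * D) ^ d with hE_def
  have hE : 0 ≤ E := by positivity
  refine ⟨√(d + d ^ 2) * (C₀ * (C₁ * √E)) + 1, by positivity, fun K x₀ hx₀ hshape p hp => ?_⟩
  set b := simplexBasis K with hb
  have h : ∀ i, 0 < b.coord i x₀ := (mem_interior_hull b).1 hx₀
  have hs : ∀ l, Metric.diam (hull (cell b x₀ h l)) ≤ g * inballDiam (hull (cell b x₀ h l)) := by
    intro l
    have h1 : shapeConst (subcell K x₀ l) ≤ γ :=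
      (Finset.le_sup' (fun i => shapeConst (subcell K x₀ i)) (Finset.mem_univ l)).trans hshape
    exact (div_le_iff₀ (exists_closedBall_subset_hull (by omega) (cell b x₀ h l)).1).1
      (h1.trans (le_max_left _ _))
  have hdiam := diam_hull_le h hd hg1 hs
  have hgrad : ∀ l j, ‖coordGrad (cell b x₀ h l) j‖ * Metric.diam (hull b) ≤ D := by
    intro l j
    have h1 := mul_le_mul_of_nonneg_left (hdiam l) (norm_nonneg (coordGrad (cell b x₀ h l) j))
    have h2 := mul_le_mul_of_nonneg_left
      (norm_coordGrad_mul_inballDiam_le_one (cell b x₀ h l) j) hD0.le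
    linarith
  obtain ⟨c, hc, hcB⟩ := hexp K x₀ h E hE (fun l => volume_hull_le h hd hD0 l (hdiam l)) p hp
  obtain ⟨v, σ, hv⟩ := hsolv b x₀ h hgrad c _ hcB
  have hfin : IsFiniteMeasure (volume.restrict (body K)) := ⟨by
    rw [Measure.restrict_apply_univ]; exact volume_hull_lt_top b⟩
  have hσ : σ = 0 :=
    hv.eq_zero_of_integral_eq_zero (hp.memLp.integrable (by norm_num)) hp.mean_zero hc
  have hvol : 0 < √(volume.real (body K)) := Real.sqrt_pos.2 (real_volume_hull_pos b)
  refine ⟨fun x => WithLp.toLp 2 fun i => v i x,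
    fun i j x => lineDeriv ℝ (v i) x (EuclideanSpace.single j 1), ⟨fun i => hv.memH10 i,
      fun i l => ?_⟩, ?_, fun x hx => ?_, fun i => hv.hasH1Grad i, ?_, ?_⟩
  · obtain ⟨q, hq1, hq2⟩ := hv.poly i l
    refine ⟨q, hq1, ?_⟩
    have hm : MeasurableSet (subcell K x₀ l) := (isCompact_hull (cell b x₀ h l)).measurableSet
    exact (ae_restrict_iff' hm).2 (Filter.Eventually.of_forall hq2)
  · refine Continuous.continuousOn ((PiLp.continuous_toLp 2 _).comp ?_)
    refine continuous_pi fun i => ?_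
    obtain ⟨L, hL⟩ := hv.lipschitz i
    exact hL.continuous
  · ext i
    exact hv.eq_zero i x hx.2
  · filter_upwards [hv.ae_sum_lineDeriv_eq hc] with x hx
    rw [hx, hσ, zero_mul, sub_zero]
  · have hp0 : 0 ≤ l2Norm (body K) p := Real.sqrt_nonneg _
    refine (h1Norm_le (volume_hull_lt_top b) (by positivity) Metric.diam_nonneg
      (fun i => Filter.Eventually.of_forall (hv.abs_le i)) hv.abs_lineDeriv_le).trans ?_
    have e : C₀ * (C₁ * √E * l2Norm (body K) p / √(volume.real (body K))) *
        √(volume.real (hull b)) = C₀ * (C₁ * √E) * l2Norm (body K) p := by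
      change _ * √(volume.real (body K)) = _
      field_simp
    rw [e]
    have hM : 0 ≤ max 1 (Metric.diam (body K)) * l2Norm (body K) p := by positivity
    change √(d + d ^ 2) * max 1 (Metric.diam (body K)) * _ ≤ _
    nlinarith
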